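/- **Setting.** Let $\Gamma$ be an infinite set of values. A schema $\mathcal G$ consists of relation names with arities, exactly one key $key(r)\subseteq\{1,\dots,arity(r)\}$ for each relation $r$ (all positions, if no key is specified), and a finite set of inclusion dependencies (INDs), possibly cyclic, of the form $\forall \vec x\,[r_1(\vec x_1)\to\exists\vec y\; r_2(\vec x_2)]$, where no variable is repeated within $\vec x_1$ or within $\vec x_2$ and $\vec y$ consists of the variables of $\vec x_2$ that do not occur in $\vec x_1$. For an IND $d$ let $\pi_R^d$ be the set of positions of $\vec x_2$ that hold a variable of $\vec x_1$; $d$ is *non-key-conflicting* (NKC) if $\pi_R^d\not\supsetneq key(r_2)$. A database is a (possibly infinite) set of facts over $\Gamma$; it is consistent if it satisfies all keys and all INDs. A consistent database $B$ is a *loosely-sound repair* of $D$ if there is no consistent $B'$ with $B'\cap D\supsetneq B\cap D$. For a union of conjunctive queries (UCQ) $q$ without comparison atoms (terms are variables or constants, and each output variable occurs in an atom of the body), $ans(q,\mathcal G,D)$ is the set of tuples that are answers to $q$ in every loosely-sound repair of $D$. **Program.** $Q$ is the perfect rewriting of $q$: starting with the disjuncts of $q$, iterate the following two steps and keep everything obtained.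 (1) If two atoms of a conjunctive query (CQ) in the current set unify, add the CQ obtained by applying their most general unifier and replacing them by the single unifying atom. (2) If an atom $r_2(\vec u)$ of a CQ in the current set and an IND $d$ from $r_1$ to $r_2$ are such that the positions of $\vec u$ outside $\pi_R^d$ hold only non-output variables that occur exactly once in the CQ, add the CQ in which this atom is replaced by the $r_1$-atom that carries the terms of $\vec u$ along $d$ and anonymous variables elsewhere. $P_{cqa}$ is the disjunctive logic program, under the answer set semantics, with the following rules. For each relation $g$ and each $i\notin key(g)$ it has $$g^c(\vec x_1)\vee g^c(\vec x_2) \leftarrow g(\vec x_1),\, g(\vec x_2),\, x_1^i\ne x_2^i,$$ where $\vec x_1,\vec x_2$ are sequences of distinct variables that coincide exactly on $key(g)$; for each relation $g$ it has $$g^r(\vec x)\leftarrow g(\vec x),\ \mathrm{not}\ g^c(\vec x);$$ and for each CQ in $Q$ it has the rule with head predicate $Q_{cqa}$ whose body is that of the CQ with each atom $g(\vec y)$ replaced by $g^r(\vec y)$. A ground atom is a *cautious consequence* of a program if it belongs to all its answer sets. **Theorem.** Let $D$ be a finite database for a schema $\mathcal G$ with exactly one key for each relation and (possibly cyclic) NKC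 INDs, and let $q$ be a UCQ without comparison atoms. Then the perfect rewriting $Q$ is finite (the iteration stops), and for every tuple $t$ of values from $\Gamma$, $$t\in ans(q,\mathcal G,D)\iff Q_{cqa}(t)\ \text{is a cautious consequence of}\ D\cup P_{cqa}.$$ -/

import Mathlib

namespace CQA

universe u v w

/-! ### Relational schemas, databases, repairs -/

/-- A fact `r(t)` over relation names `R` with arities `ar` and values `Γ`.
A database is a (possibly infinite) set of facts. -/
structure DBFact {R : Type u} (ar : R → ℕ) (Γ : Type v) where
  rel : R
  args : Fin (ar rel) → Γ

/-- An inclusion dependency `∀ x [r₁(x₁) → ∃ y r₂(x₂)]`, in which no variable is repeated inside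
`x₁` or inside `x₂`. The `k` shared (universally quantified) variables stand at the positions
`left j` of `r₁` and `right j` of `r₂`; every other position of `r₂` carries its own
existentially quantified variable. -/
structure IND {R : Type u} (ar : R → ℕ) where
  lhs : R
  rhs : R
  k : ℕ
  left : Fin k ↪ Fin (ar lhs)
  right : Fin k ↪ Fin (ar rhs)

/-- A schema with exactly one key for each relation and a finite set of INDs.
(A relation without an explicit key has as key the set of all its positions.) -/
structure Schema {R : Type u} (ar : R → ℕ) where
  key : (r : R) → Finset (Fin (ar r))
  inds : Finset (IND ar)

section Databases

variable {R : Type u} {ar : R → ℕ} {Γ : Type v}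

/-- The set `π_R^d` of positions of the right-hand relation that carry universal variables. -/
def IND.rightPos (d : IND ar) : Finset (Fin (ar d.rhs)) :=
  Finset.univ.map d.right

/-- `d` is non-key-conflicting: `π_R^d` is not a proper superset of the key of the right-hand
relation. -/
def Schema.NKC (S : Schema ar) (d : IND ar) : Prop :=
  ¬ S.key d.rhs ⊂ d.rightPos

/-- Satisfaction of an inclusion dependency. -/
def IND.Holds (d : IND ar) (B : Set (DBFact ar Γ)) : Prop :=
  ∀ x : Fin (ar d.lhs) → Γ, (⟨d.lhs, x⟩ : DBFact ar Γ) ∈ B →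
    ∃ y : Fin (ar d.rhs) → Γ, (⟨d.rhs, y⟩ : DBFact ar Γ) ∈ B ∧
      ∀ j, y (d.right j) = x (d.left j)

/-- Satisfaction of the key dependencies: for each non-key position `i` of `r`, the denial
constraint `¬ [r(x₁) ∧ r(x₂) ∧ x₁ⁱ ≠ x₂ⁱ]`, where `x₁` and `x₂` coincide on the key. -/
def Schema.KeysHold (S : Schema ar) (B : Set (DBFact ar Γ)) : Prop :=
  ∀ (r : R) (i : Fin (ar r)), i ∉ S.key r → ∀ x₁ x₂ : Fin (ar r) → Γ,
    (∀ j ∈ S.key r, x₁ j = x₂ j) →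
    ¬ ((⟨r, x₁⟩ : DBFact ar Γ) ∈ B ∧ (⟨r, x₂⟩ : DBFact ar Γ) ∈ B ∧ x₁ i ≠ x₂ i)

/-- Consistency of a database with respect to the schema. -/
def Schema.Consistent (S : Schema ar) (B : Set (DBFact ar Γ)) : Prop :=
  S.KeysHold B ∧ ∀ d ∈ S.inds, d.Holds B

/-- `B` is a loosely-sound repair for `D`. -/
def IsLooselySoundRepair (S : Schema ar) (D B : Set (DBFact ar Γ)) : Prop :=
  S.Consistent B ∧
    ¬ ∃ B' : Set (DBFact ar Γ), S.Consistent B' ∧ B ∩ D ⊂ B' ∩ D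

end Databases

/-! ### Conjunctive queries without comparison atoms -/

/-- Terms: variables from `V` and constants from `Γ`. -/
inductive Term (V : Type u) (Γ : Type v) where
  | var (x : V) : Term V Γ
  | const (c : Γ) : Term V Γ

/-- Value of a term under a valuation of the variables. -/
def Term.eval {V : Type u} {Γ : Type v} (ν : V → Γ) : Term V Γ → Γ
  | .var x => ν x
  | .const c => c

/-- Application of a substitution to a term. -/
def Term.subst {V : Type u} {W : Type w} {Γ : Type v} (θ : V → Term W Γ) :
    Term V Γ → Term W Γ
  | .var x => θ x
  | .const c => .const c

/-- A query atom. An argument `none` is the anonymous variable `_`: every occurrence of it is an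
existentially quantified variable of its own. -/
structure QAtom {R : Type u} (ar : R → ℕ) (Γ : Type v) where
  rel : R
  args : Fin (ar rel) → Option (Term ℕ Γ)

/-- A conjunctive query with `n` output terms; the variables of the body that do not occur in the
head are existentially quantified. Equalities are expressed by repeating variables. -/
structure CQ {R : Type u} (ar : R → ℕ) (Γ : Type v) (n : ℕ) where
  head : Fin n → Term ℕ Γ
  body : Finset (QAtom ar Γ)

section Queries

variable {R : Type u} {ar : R → ℕ} {Γ : Type v} {n : ℕ}

/-- Every output variable occurs in an atom of the body. -/
def CQ.Safe (c : CQ ar Γ n) : Prop :=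
  ∀ k v, c.head k = .var v → ∃ a ∈ c.body, ∃ i, a.args i = some (.var v)

/-- The valuation `ν` maps the atom `a` onto some fact of `B`. -/
def QAtom.Sat (ν : ℕ → Γ) (B : Set (DBFact ar Γ)) (a : QAtom ar Γ) : Prop :=
  ∃ x : Fin (ar a.rel) → Γ, (⟨a.rel, x⟩ : DBFact ar Γ) ∈ B ∧
    ∀ i, ∀ τ ∈ a.args i, x i = τ.eval ν

/-- The answers to a conjunctive query over `B`. -/
def CQ.ans (c : CQ ar Γ n) (B : Set (DBFact ar Γ)) : Set (Fin n → Γ) :=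
  {t | ∃ ν : ℕ → Γ, (∀ k, t k = (c.head k).eval ν) ∧ ∀ a ∈ c.body, a.Sat ν B}

/-- The answers to a union of conjunctive queries over `B`. -/
def ucqAns (q : Finset (CQ ar Γ n)) (B : Set (DBFact ar Γ)) : Set (Fin n → Γ) :=
  {t | ∃ c ∈ q, t ∈ c.ans B}

/-- The consistent answers to `q` under the loosely-sound semantics. -/
def consistentAnswers (S : Schema ar) (D : Set (DBFact ar Γ)) (q : Finset (CQ ar Γ n)) :
    Set (Fin n → Γ) :=
  {t | ∀ B : Set (DBFact ar Γ), IsLooselySoundRepair S D B → t ∈ ucqAns q B}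

/-! ### Perfect rewriting with respect to inclusion dependencies -/

/-- `θ` unifies the argument lists `x` and `y`. An anonymous variable occurs nowhere else and
unifies with every term, so it imposes no condition. -/
def Unifies {m : ℕ} (θ : ℕ → Term ℕ Γ) (x y : Fin m → Option (Term ℕ Γ)) : Prop :=
  ∀ i, ∀ τ ∈ x i, ∀ τ' ∈ y i, τ.subst θ = τ'.subst θ

/-- `θ` is an (idempotent) most general unifier of `x` and `y`: it is a unifier, and every
unifier `η` factors through it, as `η = η ∘ θ`. -/
def IsMGU {m : ℕ} (θ : ℕ → Term ℕ Γ) (x y : Fin m → Option (Term ℕ Γ)) : Prop :=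
  Unifies θ x y ∧ ∀ η : ℕ → Term ℕ Γ, Unifies η x y → ∀ v, (θ v).subst η = η v

/-- Application of a substitution to an atom; anonymous variables are left alone. -/
def QAtom.subst (θ : ℕ → Term ℕ Γ) (a : QAtom ar Γ) : QAtom ar Γ :=
  ⟨a.rel, fun i => (a.args i).map (Term.subst θ)⟩

/-- The single atom that two atoms `r(x)` and `r(y)` become under their unifier `θ`. -/
def mergedAtom (r : R) (x y : Fin (ar r) → Option (Term ℕ Γ)) (θ : ℕ → Term ℕ Γ) :
    QAtom ar Γ :=
  QAtom.subst θ ⟨r, fun i => (x i).or (y i)⟩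

open Classical in
/-- Step (1): two distinct atoms of `c` that unify are replaced by their unifying atom, and the
most general unifier is applied to the whole query. -/
def CQ.Reduces (c c' : CQ ar Γ n) : Prop :=
  ∃ (r : R) (x y : Fin (ar r) → Option (Term ℕ Γ)) (θ : ℕ → Term ℕ Γ),
    (⟨r, x⟩ : QAtom ar Γ) ∈ c.body ∧ (⟨r, y⟩ : QAtom ar Γ) ∈ c.body ∧ x ≠ y ∧
    IsMGU θ x y ∧
    c'.head = (fun k => (c.head k).subst θ) ∧
    c'.body = insert (mergedAtom r x y θ)
      (((c.body.erase ⟨r, x⟩).erase ⟨r, y⟩).image (QAtom.subst θ))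

/-- The variable `v` is unbound in `c`: it is not an output variable, and it has exactly one
occurrence in the body. -/
def CQ.Unbound (c : CQ ar Γ n) (v : ℕ) : Prop :=
  (∀ k, c.head k ≠ .var v) ∧
    ∃! o : (a : QAtom ar Γ) × Fin (ar a.rel), o.1 ∈ c.body ∧ o.1.args o.2 = some (.var v)

/-- `d` is applicable to the atom `r₂(x)` of `c`, where `r₂` is the right-hand relation of `d`:
the positions that `d` does not propagate hold only anonymous or unbound variables. -/
def IND.Applicable (d : IND ar) (c : CQ ar Γ n) (x : Fin (ar d.rhs) → Option (Term ℕ Γ)) :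
    Prop :=
  ∀ i, i ∉ d.rightPos → x i = none ∨ ∃ v, x i = some (.var v) ∧ c.Unbound v

open Classical in
/-- The atom of the left-hand relation that `d`, read from right to left, yields from `r₂(x)`:
position `left j` receives the term at `right j`, every other position an anonymous variable. -/
noncomputable def IND.rewriteAtom (d : IND ar) (x : Fin (ar d.rhs) → Option (Term ℕ Γ)) :
    QAtom ar Γ :=
  ⟨d.lhs, fun i => if h : ∃ j, d.left j = i then x (d.right h.choose) else none⟩

open Classical in
/-- Step (2): an atom of `c` to which `d` is applicable is rewritten by `d` from right to left. -/
def CQ.RewritesBy (d : IND ar) (c c' : CQ ar Γ n) : Prop :=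
  ∃ x : Fin (ar d.rhs) → Option (Term ℕ Γ),
    (⟨d.rhs, x⟩ : QAtom ar Γ) ∈ c.body ∧ d.Applicable c x ∧
    c'.head = c.head ∧
    c'.body = insert (d.rewriteAtom x) (c.body.erase ⟨d.rhs, x⟩)

/-- One iteration of the rewriting algorithm: add all results of steps (1) and (2). -/
def rewritingStep (S : Schema ar) (Q : Set (CQ ar Γ n)) : Set (CQ ar Γ n) :=
  Q ∪ {c' | ∃ c ∈ Q, c.Reduces c'} ∪ {c' | ∃ c ∈ Q, ∃ d ∈ S.inds, CQ.RewritesBy d c c'}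

/-- The perfect rewriting of `q`: start with the disjuncts of `q` and iterate until nothing new
is added. -/
def perfectRewriting (S : Schema ar) (q : Finset (CQ ar Γ n)) : Set (CQ ar Γ n) :=
  ⋃ m : ℕ, (rewritingStep S)^[m] (q : Set (CQ ar Γ n))

end Queries

/-! ### Answer set programs: ground semantics -/

/-- A ground disjunctive rule `a₁ ∨ ⋯ ∨ aₖ :- b₁, …, bₗ, not c₁, …, not cₘ`. -/
structure GroundRule (A : Type u) where
  head : List A
  pos : List A
  neg : List A

section GroundSemantics

variable {A : Type u}

/-- `M` satisfies the ground rule `ρ`. -/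
def GroundRule.Sat (M : Set A) (ρ : GroundRule A) : Prop :=
  (∀ a ∈ ρ.pos, a ∈ M) → (∀ a ∈ ρ.neg, a ∉ M) → ∃ a ∈ ρ.head, a ∈ M

/-- `M` is a model of the ground program `P`. -/
def IsModel (P : Set (GroundRule A)) (M : Set A) : Prop :=
  ∀ ρ ∈ P, ρ.Sat M

/-- The Gelfond-Lifschitz reduct of `P` with respect to `M`. -/
def reduct (P : Set (GroundRule A)) (M : Set A) : Set (GroundRule A) :=
  {ρ' | ∃ ρ ∈ P, (∀ a ∈ ρ.neg, a ∉ M) ∧ ρ' = ⟨ρ.head, ρ.pos, []⟩}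

/-- `M` is an answer set of `P`: a minimal model of the reduct of `P` with respect to `M`. -/
def IsAnswerSet (P : Set (GroundRule A)) (M : Set A) : Prop :=
  IsModel (reduct P M) M ∧ ∀ N : Set A, N ⊆ M → IsModel (reduct P M) N → N = M

end GroundSemantics

/-! ### The program with variables -/

/-- Atoms `g(x)`, `gᶜ(x)` (deleted), `gʳ(x)` (repaired) for each relation `g`, and atoms of the
`n`-ary query predicate, with arguments from `T`. -/
inductive AspAtom {R : Type u} (ar : R → ℕ) (n : ℕ) (T : Type v) where
  | base (r : R) (x : Fin (ar r) → T) : AspAtom ar n T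
  | del (r : R) (x : Fin (ar r) → T) : AspAtom ar n T
  | rep (r : R) (x : Fin (ar r) → T) : AspAtom ar n T
  | query (x : Fin n → T) : AspAtom ar n T

/-- Apply `f` to each argument of an atom. -/
def AspAtom.map {R : Type u} {ar : R → ℕ} {n : ℕ} {T : Type v} {T' : Type w} (f : T → T') :
    AspAtom ar n T → AspAtom ar n T'
  | .base r x => .base r (f ∘ x)
  | .del r x => .del r (f ∘ x)
  | .rep r x => .rep r (f ∘ x)
  | .query x => .query (f ∘ x)

/-- Variables of programs: named variables, and one variable for each position of each query
atom, used to name the anonymous variables apart. -/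
abbrev PVar {R : Type u} (ar : R → ℕ) (Γ : Type v) := ℕ ⊕ (QAtom ar Γ × ℕ)

/-- A disjunctive rule with variables; `neq` lists the built-in atoms `τ ≠ τ'` of the body. -/
structure AspRule {R : Type u} (ar : R → ℕ) (Γ : Type v) (n : ℕ) where
  head : List (AspAtom ar n (Term (PVar ar Γ) Γ))
  pos : List (AspAtom ar n (Term (PVar ar Γ) Γ))
  neg : List (AspAtom ar n (Term (PVar ar Γ) Γ))
  neq : List (Term (PVar ar Γ) Γ × Term (PVar ar Γ) Γ)

section Programs

variable {R : Type u} {ar : R → ℕ} {Γ : Type v} {n : ℕ}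

/-- The instance of a rule under a valuation of its variables. -/
def AspRule.ground (ν : PVar ar Γ → Γ) (ρ : AspRule ar Γ n) : GroundRule (AspAtom ar n Γ) :=
  ⟨ρ.head.map (AspAtom.map (Term.eval ν)), ρ.pos.map (AspAtom.map (Term.eval ν)),
    ρ.neg.map (AspAtom.map (Term.eval ν))⟩

/-- The ground instances, over the domain `Γ`, of the rules of a program whose built-in atoms are
true. -/
def grounding (P : Set (AspRule ar Γ n)) : Set (GroundRule (AspAtom ar n Γ)) :=
  {g | ∃ ρ ∈ P, ∃ ν : PVar ar Γ → Γ,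
    (∀ e ∈ ρ.neq, e.1.eval ν ≠ e.2.eval ν) ∧ g = ρ.ground ν}

/-- The ground atom `a` is a cautious consequence of `P`: it belongs to every answer set. -/
def IsCautiousConsequence (P : Set (AspRule ar Γ n)) (a : AspAtom ar n Γ) : Prop :=
  ∀ M : Set (AspAtom ar n Γ), IsAnswerSet (grounding P) M → a ∈ M

/-- The facts of `D`, as rules with an empty body. -/
def factRules (n : ℕ) (D : Set (DBFact ar Γ)) : Set (AspRule ar Γ n) :=
  {ρ | ∃ f ∈ D, ρ = ⟨[.base f.rel (fun i => .const (f.args i))], [], [], []⟩}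

/-- The first variable sequence of the key dependency of `r`. -/
def keyVars₁ (r : R) (i : Fin (ar r)) : Term (PVar ar Γ) Γ :=
  .var (.inl i)

/-- The second variable sequence of the key dependency of `r`: it coincides with the first on
the key and has new variables elsewhere. -/
def keyVars₂ (S : Schema ar) (r : R) (i : Fin (ar r)) : Term (PVar ar Γ) Γ :=
  if i ∈ S.key r then .var (.inl i) else .var (.inl (ar r + i))

/-- For each relation `r` and each non-key position `i`, the rule
`rᶜ(x₁) ∨ rᶜ(x₂) :- r(x₁), r(x₂), x₁ⁱ ≠ x₂ⁱ.` -/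
def keyRules (S : Schema ar) : Set (AspRule ar Γ n) :=
  {ρ | ∃ (r : R) (i : Fin (ar r)), i ∉ S.key r ∧
    ρ = ⟨[.del r (keyVars₁ r), .del r (keyVars₂ S r)],
      [.base r (keyVars₁ r), .base r (keyVars₂ S r)], [],
      [(keyVars₁ r i, keyVars₂ S r i)]⟩}

/-- For each relation `r`, the rule `rʳ(x) :- r(x), not rᶜ(x).` -/
def repairRules : Set (AspRule ar Γ n) :=
  {ρ | ∃ r : R, ρ = ⟨[.rep r (keyVars₁ r)], [.base r (keyVars₁ r)], [.del r (keyVars₁ r)], []⟩}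

/-- The atom `gʳ(y)` that replaces the query atom `g(y)`. -/
def QAtom.repaired (n : ℕ) (a : QAtom ar Γ) : AspAtom ar n (Term (PVar ar Γ) Γ) :=
  .rep a.rel (fun i => match a.args i with
    | some τ => τ.subst (fun v => .var (.inl v))
    | none => .var (.inr (a, i)))

/-- The conjunctive query `c` as a rule for the query predicate over the repaired relations. -/
noncomputable def CQ.toRule (c : CQ ar Γ n) : AspRule ar Γ n :=
  ⟨[.query (fun k => (c.head k).subst (fun v => .var (.inl v)))],
    c.body.toList.map (QAtom.repaired n), [], []⟩

/-- The query `Q_cqa`: the rules of the perfect rewriting of `q`, renamed to the repaired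
relations. -/
def queryRules (S : Schema ar) (q : Finset (CQ ar Γ n)) : Set (AspRule ar Γ n) :=
  CQ.toRule '' perfectRewriting S q

/-- The program `P_cqa` for the loosely-sound semantics, together with the rules of `Q_cqa`. -/
def cqaProgram (S : Schema ar) (q : Finset (CQ ar Γ n)) : Set (AspRule ar Γ n) :=
  keyRules S ∪ repairRules ∪ queryRules S q

end Programs

end CQA

namespace CQA

section Rewriting

variable {R : Type*} {ar : R → ℕ} {Γ : Type*} {n : ℕ}

/-! ### Substitutions and most general unifiers -/

/-! Both sides of the equivalence are controlled by the key repairs of `D`: the maximal subsets of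
`D` that satisfy the keys (`IsKeyRepair`).

On the logic side, the key rules force the deleted facts to hit every conflict, and minimality of an
answer set makes them a minimal hitting set, so the surviving facts form a key repair. Conversely,
each key repair yields an answer set whose query atoms are exactly the answers to the rewriting over
it (`IsAnswerSet.exists_isKeyRepair`, `IsKeyRepair.isAnswerSet`).

On the database side, a finite key-consistent `K` is chased: a missing fact required by an IND is
inserted with fresh values at the positions not propagated. The NKC condition keeps the keys intact.
Cyclic INDs may make the chase infinite, but no stage produces a new answer to the rewriting: a
match that uses the inserted fact can be pulled back along the IND, once unification has left only
one atom on that fact (`exists_ans_injective`, `ans_of_ans_insert_freshImage`). A CQ has a finite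
body, so this passes to the limit (`exists_consistent_extension`). Hence `B ∩ D` is a key repair for
every loosely-sound repair `B`, and every key repair extends to a loosely-sound repair without
gaining answers. The converse direction needs only that the rewriting is sound over databases
satisfying the INDs (`mem_ucqAns_of_mem_perfectRewriting`).

The rewriting is finite because most general unifiers introduce no new terms and new existential
positions are anonymous. -/

theorem Term.eval_subst {V W : Type*} (ν : W → Γ) (θ : V → Term W Γ) (τ : Term V Γ) :
    (τ.subst θ).eval ν = τ.eval (fun v => (θ v).eval ν) := by
  cases τ <;> rfl

theorem Term.subst_const_comp {V W : Type*} (ν : V → Γ) (τ : Term V Γ) :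
    τ.subst (fun v => (.const (ν v) : Term W Γ)) = .const (τ.eval ν) := by
  cases τ <;> rfl

theorem Term.subst_congr_of_ne {V W : Type*} [DecidableEq V] {θ : V → Term W Γ} {v : V}
    {σ : Term W Γ} {τ : Term V Γ} (h : τ ≠ .var v) :
    τ.subst (Function.update θ v σ) = τ.subst θ := by
  cases τ with
  | var w =>
    have : w ≠ v := fun e => h (by rw [e])
    simp [Term.subst, this]
  | const c => rfl

/-- Two argument lists that agree under a valuation have a most general unifier, through which
the valuation factors. -/
theorem exists_isMGU {m : ℕ} {x y : Fin m → Option (Term ℕ Γ)} {ν : ℕ → Γ}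
    (h : ∀ i, ∀ τ ∈ x i, ∀ τ' ∈ y i, τ.eval ν = τ'.eval ν) :
    ∃ θ, IsMGU θ x y ∧ ∀ v, (θ v).eval ν = ν v := by
  classical
  have h0 : Unifies (fun v => (.const (ν v) : Term ℕ Γ)) x y := fun i τ hτ τ' hτ' => by
    rw [Term.subst_const_comp, Term.subst_const_comp, h i τ hτ τ' hτ']
  -- The unifier is defined semantically, without an algorithm. A variable goes to a constant if all
  -- unifiers force one, which must be `ν v` by `h0`; otherwise it goes to the least variable that
  -- all unifiers identify with it.
  let rep : ℕ → ℕ := fun v => sInf {w | ∀ η, Unifies η x y → η w = η v}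
  have hrep : ∀ v η, Unifies η x y → η (rep v) = η v := fun v =>
    Nat.sInf_mem (s := {w | ∀ η, Unifies η x y → η w = η v}) ⟨v, fun _ _ => rfl⟩
  let θ : ℕ → Term ℕ Γ := fun v =>
    if ∀ η, Unifies η x y → η v = .const (ν v) then .const (ν v) else .var (rep v)
  have hθ : ∀ v w, (∀ η, Unifies η x y → η v = η w) → θ v = θ w := by
    intro v w hvw
    have hν : ν v = ν w := by simpa using hvw _ h0
    have hr : rep v = rep w := by
      simp only [rep]
      congr 1
      ext u
      exact forall₂_congr fun η hη => by rw [hvw η hη]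
    have hc : (∀ η, Unifies η x y → η v = .const (ν v)) ↔
        ∀ η, Unifies η x y → η w = .const (ν w) :=
      forall₂_congr fun η hη => by rw [hvw η hη, hν]
    show (if _ then _ else _) = if _ then _ else _
    rw [if_congr hc (by rw [hν]) (by rw [hr])]
  have hθc : ∀ v c, (∀ η, Unifies η x y → η v = .const c) → θ v = .const c := by
    intro v c hv
    have hν : ν v = c := by simpa using hv _ h0
    subst hν
    exact if_pos hv
  have hmgu : IsMGU θ x y := by
    refine ⟨?_, fun η hη v => ?_⟩
    · intro i τ hτ τ' hτ'
      cases τ with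
      | var v =>
        cases τ' with
        | var w => exact hθ v w fun η hη => hη i _ hτ _ hτ'
        | const c => exact hθc v c fun η hη => hη i _ hτ _ hτ'
      | const c =>
        cases τ' with
        | var w => exact (hθc w c fun η hη => (hη i _ hτ _ hτ').symm).symm
        | const c' => exact congrArg Term.const (h i _ hτ _ hτ')
    · by_cases hv : ∀ η, Unifies η x y → η v = .const (ν v)
      · rw [hθc v _ hv, hv η hη]
        rfl
      · have : θ v = .var (rep v) := if_neg hv
        rw [this]
        exact hrep v η hη
  refine ⟨θ, hmgu, fun v => ?_⟩
  have := hmgu.2 _ h0 v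
  rw [Term.subst_const_comp] at this
  simpa using this

/-- A most general unifier moves variables only to terms of the unified argument lists. -/
theorem IsMGU.eq_var_or_mem [Nontrivial Γ] {m : ℕ} {x y : Fin m → Option (Term ℕ Γ)}
    {θ : ℕ → Term ℕ Γ} (h : IsMGU θ x y) {T : Set (Term ℕ Γ)}
    (hx : ∀ i, ∀ τ ∈ x i, τ ∈ T) (hy : ∀ i, ∀ τ ∈ y i, τ ∈ T) (v : ℕ) :
    θ v = .var v ∨ θ v ∈ T := by
  classical
  by_contra! hv
  obtain ⟨hne, hT⟩ := hv
  cases hθ : θ v with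
  -- A constant outside `T` could be exchanged for another in the values of `θ`; the result still
  -- unifies but does not factor through `θ`.
  | const c =>
    rw [hθ] at hT
    obtain ⟨c', hc'⟩ := exists_ne c
    let g : Term ℕ Γ → Term ℕ Γ := fun τ => if τ = .const c then .const c' else τ
    have hg : ∀ τ ∈ T, τ.subst (fun u => g (θ u)) = g (τ.subst θ) := by
      intro τ hτ
      cases τ with
      | var u => rfl
      | const e =>
        have : (Term.const e : Term ℕ Γ) ≠ .const c := fun h => hT (h ▸ hτ)
        simp [Term.subst, g, this]
    have := h.2 (fun u => g (θ u)) (fun i τ hτ τ' hτ' => by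
      rw [hg τ (hx i τ hτ), hg τ' (hy i τ' hτ'), h.1 i τ hτ τ' hτ']) v
    simp only [hθ, Term.subst, g, if_true, Term.const.injEq] at this
    exact hc' this.symm
  -- Here `w` does not occur in `T`, so resetting `θ w` to a constant leaves a unifier; factoring it
  -- at `v` would equate that constant with `var w`.
  | var w =>
    rw [hθ] at hT hne
    obtain ⟨c⟩ : Nonempty Γ := inferInstance
    have hu : ∀ τ ∈ T, τ.subst (Function.update θ w (.const c)) = τ.subst θ := fun τ hτ =>
      Term.subst_congr_of_ne fun e => hT (e ▸ hτ)
    have := h.2 (Function.update θ w (.const c)) (fun i τ hτ τ' hτ' => by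
      rw [hu τ (hx i τ hτ), hu τ' (hy i τ' hτ'), h.1 i τ hτ τ' hτ']) v
    have hvw : v ≠ w := fun e => hne (by rw [e])
    simp [hθ, Term.subst, Function.update_of_ne hvw] at this

/-! ### Finiteness of the perfect rewriting -/

theorem subset_perfectRewriting (S : Schema ar) (q : Finset (CQ ar Γ n)) :
    (q : Set (CQ ar Γ n)) ⊆ perfectRewriting S q :=
  fun _ hc => Set.mem_iUnion.2 ⟨0, hc⟩

theorem rewritingStep_perfectRewriting_subset (S : Schema ar) (q : Finset (CQ ar Γ n)) :
    rewritingStep S (perfectRewriting S q) ⊆ perfectRewriting S q := by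
  rintro c' ((hc | ⟨c, hc, h⟩) | ⟨c, hc, h⟩)
  · exact hc
  all_goals
    obtain ⟨m, hm⟩ := Set.mem_iUnion.1 hc
    refine Set.mem_iUnion.2 ⟨m + 1, ?_⟩
    rw [Function.iterate_succ_apply']
  · exact .inl (.inr ⟨c, hm, h⟩)
  · exact .inr ⟨c, hm, h⟩

theorem perfectRewriting_reduces {S : Schema ar} {q : Finset (CQ ar Γ n)} {c c' : CQ ar Γ n}
    (hc : c ∈ perfectRewriting S q) (h : c.Reduces c') : c' ∈ perfectRewriting S q :=
  rewritingStep_perfectRewriting_subset S q (.inl (.inr ⟨c, hc, h⟩))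

theorem perfectRewriting_rewritesBy {S : Schema ar} {q : Finset (CQ ar Γ n)} {d : IND ar}
    (hd : d ∈ S.inds) {c c' : CQ ar Γ n} (hc : c ∈ perfectRewriting S q)
    (h : CQ.RewritesBy d c c') : c' ∈ perfectRewriting S q :=
  rewritingStep_perfectRewriting_subset S q (.inr ⟨c, hc, d, hd, h⟩)

/-- Induction along the rewriting algorithm. -/
theorem perfectRewriting_induction {S : Schema ar} {q : Finset (CQ ar Γ n)}
    {p : CQ ar Γ n → Prop} (base : ∀ c ∈ q, p c)
    (reduces : ∀ c c', p c → c.Reduces c' → p c')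
    (rewrites : ∀ d ∈ S.inds, ∀ c c', p c → CQ.RewritesBy d c c' → p c')
    {c : CQ ar Γ n} (hc : c ∈ perfectRewriting S q) : p c := by
  obtain ⟨m, hm⟩ := Set.mem_iUnion.1 hc
  induction m generalizing c with
  | zero => exact base c hm
  | succ m ih =>
    rw [Function.iterate_succ_apply'] at hm
    rcases hm with (hm | ⟨c₀, hm, h⟩) | ⟨c₀, hm, d, hd, h⟩
    · exact ih (Set.mem_iUnion.2 ⟨m, hm⟩) hm
    · exact reduces c₀ c (ih (Set.mem_iUnion.2 ⟨m, hm⟩) hm) h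
    · exact rewrites d hd c₀ c (ih (Set.mem_iUnion.2 ⟨m, hm⟩) hm) h

/-- The atoms over the relations `P` with terms from `T`. -/
def QAtom.over (P : Set R) (T : Set (Term ℕ Γ)) : Set (QAtom ar Γ) :=
  {a | a.rel ∈ P ∧ ∀ i, ∀ τ ∈ a.args i, τ ∈ T}

/-- The conjunctive queries over the relations `P` with terms from `T`. -/
def CQ.over (P : Set R) (T : Set (Term ℕ Γ)) : Set (CQ ar Γ n) :=
  {c | (∀ k, c.head k ∈ T) ∧ ∀ a ∈ c.body, a ∈ QAtom.over P T}

theorem QAtom.finite_over {P : Set R} {T : Set (Term ℕ Γ)} (hP : P.Finite) (hT : T.Finite) :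
    (QAtom.over P T : Set (QAtom ar Γ)).Finite := by
  refine Set.Finite.subset (hP.biUnion fun r _ => Set.Finite.image (QAtom.mk r)
    (Set.Finite.pi (t := fun _ : Fin (ar r) => insert none (some '' T))
      fun _ => (hT.image some).insert none)) ?_
  rintro ⟨r, x⟩ ⟨hr, hx⟩
  refine Set.mem_biUnion hr ⟨x, fun i _ => ?_, rfl⟩
  cases h : x i with
  | none => exact .inl rfl
  | some τ => exact .inr ⟨τ, hx i τ h, rfl⟩

theorem CQ.finite_over {P : Set R} {T : Set (Term ℕ Γ)} (hP : P.Finite) (hT : T.Finite) :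
    (CQ.over P T : Set (CQ ar Γ n)).Finite := by
  have hA := QAtom.finite_over (ar := ar) hP hT
  refine Set.Finite.subset (Set.Finite.image2 CQ.mk
    (Set.Finite.pi (t := fun _ : Fin n => T) fun _ => hT)
    (hA.toFinset.powerset.finite_toSet)) ?_
  rintro ⟨hd, bd⟩ ⟨h₁, h₂⟩
  refine ⟨hd, fun k _ => h₁ k, bd, ?_, rfl⟩
  simp only [Finset.coe_powerset, Set.Finite.coe_toFinset, Set.mem_preimage, Set.mem_powerset_iff]
  exact h₂

theorem CQ.exists_over (q : Finset (CQ ar Γ n)) :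
    ∃ (P : Set R) (T : Set (Term ℕ Γ)), P.Finite ∧ T.Finite ∧ ∀ c ∈ q, c ∈ CQ.over P T := by
  refine ⟨⋃ c ∈ q, ⋃ a ∈ c.body, {a.rel},
    ⋃ c ∈ q, (Set.range c.head ∪ ⋃ a ∈ c.body, some ⁻¹' Set.range a.args), ?_, ?_, ?_⟩
  · exact q.finite_toSet.biUnion fun c _ => c.body.finite_toSet.biUnion fun a _ =>
      Set.finite_singleton _
  · exact q.finite_toSet.biUnion fun c _ => (Set.finite_range _).union
      (c.body.finite_toSet.biUnion fun a _ =>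
        (Set.finite_range _).preimage (Option.some_injective _).injOn)
  · intro c hc
    refine ⟨fun k => ?_, fun a ha => ⟨?_, fun i τ hτ => ?_⟩⟩
    · exact Set.mem_biUnion hc (.inl ⟨k, rfl⟩)
    · exact Set.mem_biUnion hc (Set.mem_biUnion ha rfl)
    · exact Set.mem_biUnion hc (.inr (Set.mem_biUnion ha ⟨i, hτ⟩))

theorem QAtom.over_mono {P P' : Set R} {T : Set (Term ℕ Γ)} (h : P ⊆ P') :
    (QAtom.over P T : Set (QAtom ar Γ)) ⊆ QAtom.over P' T :=
  fun _ ha => ⟨h ha.1, ha.2⟩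

theorem CQ.over_mono {P P' : Set R} {T : Set (Term ℕ Γ)} (h : P ⊆ P') :
    (CQ.over P T : Set (CQ ar Γ n)) ⊆ CQ.over P' T :=
  fun _ hc => ⟨hc.1, fun a ha => QAtom.over_mono h (hc.2 a ha)⟩

theorem CQ.over_of_reduces [Nontrivial Γ] {P : Set R} {T : Set (Term ℕ Γ)} {c c' : CQ ar Γ n}
    (hc : c ∈ CQ.over P T) (h : c.Reduces c') : c' ∈ CQ.over P T := by
  classical
  obtain ⟨r, x, y, θ, hx, hy, -, hθ, hhead, hbody⟩ := h
  have hθT : ∀ τ ∈ T, τ.subst θ ∈ T := by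
    intro τ hτ
    cases τ with
    | const c => exact hτ
    | var v =>
      rcases hθ.eq_var_or_mem (hc.2 _ hx).2 (hc.2 _ hy).2 v with h | h
      · simpa [Term.subst, h] using hτ
      · exact h
  have hsub : ∀ a ∈ (QAtom.over P T : Set (QAtom ar Γ)), a.subst θ ∈ QAtom.over P T := by
    rintro a ⟨har, ha⟩
    refine ⟨har, fun i τ hτ => ?_⟩
    obtain ⟨σ, hσ, rfl⟩ := Option.mem_map.1 hτ
    exact hθT σ (ha i σ hσ)
  refine ⟨fun k => ?_, fun a ha => ?_⟩
  · rw [hhead]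
    exact hθT _ (hc.1 k)
  · rw [hbody, Finset.mem_insert] at ha
    rcases ha with rfl | ha
    · refine hsub _ ⟨(hc.2 _ hx).1, fun i τ hτ => ?_⟩
      rcases Option.or_eq_some_iff.1 hτ with h | h
      · exact (hc.2 _ hx).2 i τ h
      · exact (hc.2 _ hy).2 i τ h.2
    · obtain ⟨b, hb, rfl⟩ := Finset.mem_image.1 ha
      exact hsub _ (hc.2 _ (Finset.mem_of_mem_erase (Finset.mem_of_mem_erase hb)))

theorem IND.rewriteAtom_left (d : IND ar) (x : Fin (ar d.rhs) → Option (Term ℕ Γ)) (j : Fin d.k) :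
    (d.rewriteAtom x).args (d.left j) = x (d.right j) := by
  have h : ∃ j', d.left j' = d.left j := ⟨j, rfl⟩
  have : h.choose = j := d.left.injective h.choose_spec
  simp only [IND.rewriteAtom, dif_pos h, this]

theorem IND.exists_of_rewriteAtom_eq_some {d : IND ar} {x : Fin (ar d.rhs) → Option (Term ℕ Γ)}
    {i : Fin (ar d.lhs)} {τ : Term ℕ Γ} (h : (d.rewriteAtom x).args i = some τ) :
    ∃ j, d.left j = i ∧ x (d.right j) = some τ := by
  by_cases hi : ∃ j, d.left j = i
  · obtain ⟨j, rfl⟩ := hi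
    exact ⟨j, rfl, by rw [← h, d.rewriteAtom_left]⟩
  · simp [IND.rewriteAtom, hi] at h

theorem CQ.over_of_rewritesBy {P : Set R} {T : Set (Term ℕ Γ)} {d : IND ar} {c c' : CQ ar Γ n}
    (hd : d.lhs ∈ P) (hc : c ∈ CQ.over P T) (h : CQ.RewritesBy d c c') : c' ∈ CQ.over P T := by
  classical
  obtain ⟨x, hx, -, hhead, hbody⟩ := h
  refine ⟨fun k => by rw [hhead]; exact hc.1 k, fun a ha => ?_⟩
  rw [hbody, Finset.mem_insert] at ha
  rcases ha with rfl | ha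
  · refine ⟨hd, fun i τ hτ => ?_⟩
    obtain ⟨j, -, hj⟩ := IND.exists_of_rewriteAtom_eq_some hτ
    exact (hc.2 _ hx).2 _ τ hj
  · exact hc.2 _ (Finset.mem_of_mem_erase ha)

/-- All queries obtained stay in a fixed finite vocabulary: the terms of `q`, its relations, and the
left-hand relations of the INDs. -/
theorem perfectRewriting_finite [Nontrivial Γ] (S : Schema ar) (q : Finset (CQ ar Γ n)) :
    (perfectRewriting S q).Finite := by
  obtain ⟨P, T, hP, hT, hq⟩ := CQ.exists_over q
  refine (CQ.finite_over (hP.union (S.inds.finite_toSet.image IND.lhs)) hT).subset fun c hc => ?_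
  exact perfectRewriting_induction (fun c hc => CQ.over_mono Set.subset_union_left (hq c hc))
    (fun _ _ => CQ.over_of_reduces)
    (fun d hd _ _ => CQ.over_of_rewritesBy (.inr (Set.mem_image_of_mem _ hd))) hc

/-! ### Soundness of the perfect rewriting -/

theorem QAtom.Sat.mono {ν : ℕ → Γ} {B B' : Set (DBFact ar Γ)} {a : QAtom ar Γ} (h : B ⊆ B')
    (ha : a.Sat ν B) : a.Sat ν B' := by
  obtain ⟨x, hx, hx'⟩ := ha
  exact ⟨x, h hx, hx'⟩

theorem CQ.ans_mono (c : CQ ar Γ n) {B B' : Set (DBFact ar Γ)} (h : B ⊆ B') :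
    c.ans B ⊆ c.ans B' :=
  fun _ ht => ht.imp fun _ hν => ⟨hν.1, fun a ha => (hν.2 a ha).mono h⟩

theorem QAtom.subst_sat {ν : ℕ → Γ} {θ : ℕ → Term ℕ Γ} {B : Set (DBFact ar Γ)}
    {a : QAtom ar Γ} : (a.subst θ).Sat ν B ↔ a.Sat (fun v => (θ v).eval ν) B := by
  refine exists_congr fun x => and_congr Iff.rfl (forall_congr' fun i => ?_)
  simp only [QAtom.subst, Option.mem_map, forall_exists_index, and_imp,
    forall_apply_eq_imp_iff₂, Term.eval_subst]

theorem CQ.ans_subset_of_reduces {c c' : CQ ar Γ n} (h : c.Reduces c') (B : Set (DBFact ar Γ)) :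
    c'.ans B ⊆ c.ans B := by
  classical
  obtain ⟨r, x, y, θ, hx, hy, -, hθ, hhead, hbody⟩ := h
  rintro t ⟨ν, ht, hν⟩
  refine ⟨fun v => (θ v).eval ν, fun k => ?_, fun a ha => ?_⟩
  · rw [ht k, hhead, Term.eval_subst]
  · obtain ⟨z, hz, hz'⟩ := QAtom.subst_sat.1 (hν (mergedAtom r x y θ) (by simp [hbody]))
    by_cases hax : a = ⟨r, x⟩
    · subst hax
      exact ⟨z, hz, fun i τ hτ => hz' i τ (Option.or_eq_some_iff.2 (.inl hτ))⟩
    by_cases hay : a = ⟨r, y⟩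
    · subst hay
      refine ⟨z, hz, fun i τ hτ => ?_⟩
      -- The merged atom keeps the term of `x` where there is one; the value required by `y` there
      -- comes from the unifier equation.
      cases hxi : x i with
      | none => exact hz' i τ (by simpa [hxi] using hτ)
      | some σ =>
        rw [hz' i σ (by simp [hxi]), ← Term.eval_subst, ← Term.eval_subst,
          hθ.1 i σ hxi τ hτ]
    · refine QAtom.subst_sat.1 (hν _ ?_)
      rw [hbody]
      exact Finset.mem_insert_of_mem (Finset.mem_image_of_mem _
        (Finset.mem_erase.2 ⟨hay, Finset.mem_erase.2 ⟨hax, ha⟩⟩))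

theorem IND.mem_rightPos {d : IND ar} {i : Fin (ar d.rhs)} :
    i ∈ d.rightPos ↔ ∃ j, d.right j = i := by
  simp [IND.rightPos]

/-- The fact supplied by the IND matches the original atom after the unbound variables at
non-propagated positions are revalued. This disturbs nothing else, because each of them has a single
occurrence. -/
theorem CQ.ans_subset_of_rewritesBy {d : IND ar} {c c' : CQ ar Γ n}
    (h : CQ.RewritesBy d c c') {B : Set (DBFact ar Γ)} (hB : d.Holds B) :
    c'.ans B ⊆ c.ans B := by
  classical
  obtain ⟨u, hu, happ, hhead, hbody⟩ := h
  rintro t ⟨ν, ht, hν⟩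
  obtain ⟨x, hx, hxu⟩ := hν (d.rewriteAtom u) (by simp [hbody])
  obtain ⟨y, hy, hyx⟩ := hB x hx
  let p : ℕ → Fin (ar d.rhs) → Prop := fun v i =>
    i ∉ d.rightPos ∧ u i = some (.var v) ∧ c.Unbound v
  have hp : ∀ v, ¬ c.Unbound v → ¬ ∃ i, p v i := fun v hv ⟨i, hi⟩ => hv hi.2.2
  let ν' : ℕ → Γ := fun v => if hv : ∃ i, p v i then y hv.choose else ν v
  have hν' : ∀ v, (¬ ∃ i, p v i) → ν' v = ν v := fun v hv => dif_neg hv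
  have hocc : ∀ a ∈ c.body, ∀ i v, a.args i = some (.var v) → ∀ i', p v i' →
      (⟨a, i⟩ : (a : QAtom ar Γ) × Fin (ar a.rel)) = ⟨⟨d.rhs, u⟩, i'⟩ :=
    fun a ha i v hi i' hi' => hi'.2.2.2.unique ⟨ha, hi⟩ ⟨hu, hi'.2.1⟩
  refine ⟨ν', fun k => ?_, fun a ha => ?_⟩
  · rw [ht k, hhead]
    cases hk : c.head k with
    | const e => rfl
    | var v => exact (hν' v (hp v fun hv => hv.1 k hk)).symm
  · by_cases hau : a = ⟨d.rhs, u⟩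
    · subst hau
      refine ⟨y, hy, fun i τ hτ => ?_⟩
      have hτ : u i = some τ := hτ
      by_cases hi : i ∈ d.rightPos
      · obtain ⟨j, rfl⟩ := IND.mem_rightPos.1 hi
        rw [hyx, hxu (d.left j) τ (by rw [d.rewriteAtom_left]; exact hτ)]
        cases τ with
        | const e => rfl
        | var v =>
          refine (hν' v ?_).symm
          rintro ⟨i', hi'⟩
          have := hocc _ hu (d.right j) v hτ i' hi'
          simp only [Sigma.mk.injEq, heq_eq_eq, true_and] at this
          exact hi'.1 (this ▸ hi)
      · rcases happ i hi with h | ⟨v, hv, hun⟩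
        · rw [h] at hτ
          cases hτ
        · rw [hv] at hτ
          cases hτ
          have hex : ∃ i', p v i' := ⟨i, hi, hv, hun⟩
          have := hocc _ hu i v hv _ hex.choose_spec
          simp only [Sigma.mk.injEq, heq_eq_eq, true_and] at this
          show y i = ν' v
          simp only [ν', dif_pos hex, ← this]
    · obtain ⟨z, hz, hza⟩ := hν a (by
        rw [hbody]; exact Finset.mem_insert_of_mem (Finset.mem_erase.2 ⟨hau, ha⟩))
      refine ⟨z, hz, fun i τ hτ => ?_⟩
      rw [hza i τ hτ]
      cases τ with
      | const e => rfl
      | var v =>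
        refine (hν' v ?_).symm
        rintro ⟨i', hi'⟩
        exact hau (congrArg Sigma.fst (hocc a ha i v hτ i' hi'))

/-- Over a database that satisfies the inclusion dependencies, the perfect rewriting yields only
answers to the original query. -/
theorem mem_ucqAns_of_mem_perfectRewriting {S : Schema ar} {q : Finset (CQ ar Γ n)}
    {B : Set (DBFact ar Γ)} (hB : ∀ d ∈ S.inds, d.Holds B) {c : CQ ar Γ n}
    (hc : c ∈ perfectRewriting S q) {t : Fin n → Γ} (ht : t ∈ c.ans B) : t ∈ ucqAns q B := by
  revert ht
  exact perfectRewriting_induction (p := fun c => t ∈ c.ans B → t ∈ ucqAns q B)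
    (fun c hc ht => ⟨c, hc, ht⟩)
    (fun c c' ih h ht => ih (CQ.ans_subset_of_reduces h B ht))
    (fun d hd c c' ih h ht => ih (CQ.ans_subset_of_rewritesBy h (hB d hd) ht)) hc

end Rewriting

section Chase

variable {R : Type*} {ar : R → ℕ} {Γ : Type*} {n : ℕ}

/-! ### Completeness of the perfect rewriting for one inserted fact -/

/-- An answer over a set of queries that is closed under unification of atoms is witnessed by a
query and a valuation that never maps two distinct atoms to the same fact. -/
theorem exists_ans_injective {Q : Set (CQ ar Γ n)} (hQ : ∀ c ∈ Q, ∀ c', c.Reduces c' → c' ∈ Q)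
    {B : Set (DBFact ar Γ)} {t : Fin n → Γ} {c : CQ ar Γ n} (hc : c ∈ Q) (ht : t ∈ c.ans B) :
    ∃ c ∈ Q, ∃ ν : ℕ → Γ, (∀ k, t k = (c.head k).eval ν) ∧ (∀ a ∈ c.body, a.Sat ν B) ∧
      ∀ f ∈ B, ∀ a ∈ c.body, ∀ a' ∈ c.body, a.Sat ν {f} → a'.Sat ν {f} → a = a' := by
  classical
  -- Two atoms with a common image have an mgu through which `ν` factors; merging them keeps the
  -- answer and shrinks the body.
  induction hm : c.body.card using Nat.strong_induction_on generalizing c with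
  | _ m ih =>
  obtain ⟨ν, hhead, hν⟩ := ht
  by_contra! hcon
  obtain ⟨f, hf, ⟨r, x⟩, ha, ⟨r', y⟩, ha', ⟨z, hz, hzx⟩, ⟨z', hz', hzy⟩, hne⟩ :=
    hcon c hc ν hhead hν
  obtain rfl : (⟨r, z⟩ : DBFact ar Γ) = f := hz
  have hz' : (⟨r', z'⟩ : DBFact ar Γ) = ⟨r, z⟩ := hz'
  cases hz'
  have hxy : x ≠ y := fun h => hne (by rw [h])
  obtain ⟨θ, hθ, hθν⟩ := exists_isMGU (x := x) (y := y) (ν := ν) fun i τ hτ τ' hτ' => by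
    rw [← hzx i τ hτ, ← hzy i τ' hτ']
  have hθν : (fun v => (θ v).eval ν) = ν := funext hθν
  let c' : CQ ar Γ n := ⟨fun k => (c.head k).subst θ, insert (mergedAtom r x y θ)
      (((c.body.erase ⟨r, x⟩).erase ⟨r, y⟩).image (QAtom.subst θ))⟩
  have hc' : c' ∈ Q := hQ c hc c' ⟨r, x, y, θ, ha, ha', hxy, hθ, rfl, rfl⟩
  have hmem : (⟨r, y⟩ : QAtom ar Γ) ∈ c.body.erase ⟨r, x⟩ := Finset.mem_erase.2 ⟨hne.symm, ha'⟩
  have hcard : c'.body.card < m := by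
    have h₁ := Finset.card_erase_add_one ha
    have h₂ := Finset.card_erase_add_one hmem
    have h₃ : c'.body.card ≤ _ := Finset.card_insert_le _ _
    have h₄ := Finset.card_image_le (s := (c.body.erase ⟨r, x⟩).erase ⟨r, y⟩)
      (f := QAtom.subst θ)
    omega
  have ht' : t ∈ c'.ans B := by
    refine ⟨ν, fun k => ?_, fun a ha => ?_⟩
    · rw [Term.eval_subst, hθν]
      exact hhead k
    · rcases Finset.mem_insert.1 ha with rfl | ha
      · refine QAtom.subst_sat.2 ⟨z, hf, fun i τ hτ => ?_⟩
        rw [hθν]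
        rcases Option.or_eq_some_iff.1 hτ with h | h
        · exact hzx i τ h
        · exact hzy i τ h.2
      · obtain ⟨b, hb, rfl⟩ := Finset.mem_image.1 ha
        rw [QAtom.subst_sat, hθν]
        exact hν b (Finset.mem_of_mem_erase (Finset.mem_of_mem_erase hb))
  obtain ⟨c'', h₁, ν', h₂, h₃, h₄⟩ := ih _ hcard hc' ht' rfl
  obtain ⟨f, hf, a, ha, a', ha', h₅, h₆, h₇⟩ := hcon c'' h₁ ν' h₂ h₃
  exact h₇ (h₄ f hf a ha a' ha' h₅ h₆)

/-- `F` contains the values of the database `K`. -/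
def ValuesIn (K : Set (DBFact ar Γ)) (F : Set Γ) : Prop :=
  ∀ f ∈ K, ∀ i, f.args i ∈ F

/-- `F` contains the constants in the bodies of the queries in `Q`. -/
def ConstantsIn (Q : Set (CQ ar Γ n)) (F : Set Γ) : Prop :=
  ∀ c ∈ Q, ∀ a ∈ c.body, ∀ i e, a.args i = some (.const e) → e ∈ F

/-- The tuple `y` carries the values of `x` along `d`, and pairwise distinct values outside `F`
at the remaining positions. -/
structure IND.FreshImage (d : IND ar) (F : Set Γ) (x : Fin (ar d.lhs) → Γ)
    (y : Fin (ar d.rhs) → Γ) : Prop where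
  right : ∀ j, y (d.right j) = x (d.left j)
  fresh : ∀ i, i ∉ d.rightPos → y i ∉ F
  inj : ∀ i, i ∉ d.rightPos → ∀ i', y i' = y i → i' = i

theorem IND.exists_freshImage [Infinite Γ] (d : IND ar) {F : Set Γ} (hF : F.Finite)
    {x : Fin (ar d.lhs) → Γ} (hx : ∀ i, x i ∈ F) : ∃ y, d.FreshImage F x y := by
  classical
  have e := hF.infinite_compl.natEmbedding
  let y : Fin (ar d.rhs) → Γ := fun i =>
    if h : ∃ j, d.right j = i then x (d.left h.choose) else e i
  have hr : ∀ j, y (d.right j) = x (d.left j) := by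
    intro j
    have h : ∃ j', d.right j' = d.right j := ⟨j, rfl⟩
    have hj : h.choose = j := d.right.injective h.choose_spec
    simp only [y, dif_pos h, hj]
  have hn : ∀ i, i ∉ d.rightPos → y i = e i := fun i hi =>
    dif_neg fun h => hi (IND.mem_rightPos.2 h)
  have hfresh : ∀ i, i ∉ d.rightPos → y i ∉ F := fun i hi => by
    rw [hn i hi]
    exact (e i).2
  refine ⟨y, hr, hfresh, fun i hi i' h => ?_⟩
  by_cases hi' : i' ∈ d.rightPos
  · obtain ⟨j, rfl⟩ := IND.mem_rightPos.1 hi'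
    exact (hfresh i hi (by rw [← h, hr]; exact hx _)).elim
  · rw [hn i hi, hn i' hi'] at h
    exact Fin.ext (e.injective (Subtype.ext h))

/-- Inserting the fact that an inclusion dependency requires, with fresh values at the positions
that are not propagated, yields no new answers to a set of queries closed under rewriting. -/
theorem ans_of_ans_insert_freshImage {Q : Set (CQ ar Γ n)}
    (hred : ∀ c ∈ Q, ∀ c', c.Reduces c' → c' ∈ Q) {d : IND ar}
    (hrew : ∀ c ∈ Q, ∀ c', CQ.RewritesBy d c c' → c' ∈ Q)
    {K : Set (DBFact ar Γ)} {F : Set Γ} (hK : ValuesIn K F) (hQ : ConstantsIn Q F)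
    {t : Fin n → Γ} (ht : ∀ k, t k ∈ F) {x : Fin (ar d.lhs) → Γ} (hx : ⟨d.lhs, x⟩ ∈ K)
    {y : Fin (ar d.rhs) → Γ} (hy : d.FreshImage F x y)
    (h : ∃ c ∈ Q, t ∈ c.ans (insert ⟨d.rhs, y⟩ K)) : ∃ c ∈ Q, t ∈ c.ans K := by
  classical
  obtain ⟨c, hc, h⟩ := h
  -- Injectivity on atoms ensures that at most one atom needs the inserted fact.
  obtain ⟨c, hc, ν, hhead, hν, hinj⟩ := exists_ans_injective hred hc h
  by_cases hall : ∀ a ∈ c.body, a.Sat ν K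
  · exact ⟨c, hc, ν, hhead, hall⟩
  push Not at hall
  obtain ⟨⟨r, u⟩, ha, haK⟩ := hall
  obtain ⟨z, hz | hz, hzu⟩ := hν _ ha
  swap
  · exact (haK ⟨z, hz, hzu⟩).elim
  cases hz
  have hothers : ∀ b ∈ c.body, b ≠ ⟨d.rhs, u⟩ → b.Sat ν K := by
    intro b hb hne
    obtain ⟨w, hw | hw, hwb⟩ := hν b hb
    · exact (hne (hinj _ (.inl rfl) b hb _ ha ⟨w, hw, hwb⟩ ⟨y, rfl, hzu⟩)).elim
    · exact ⟨w, hw, hwb⟩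
  -- A term at a non-propagated position evaluates outside `F`. So it is no constant, no output
  -- variable, and has no occurrence in another atom, whose values lie in `K`; `hy.inj` excludes a
  -- second occurrence in the same atom.
  have happ : d.Applicable c u := by
    intro i hi
    cases hui : u i with
    | none => exact .inl rfl
    | some τ =>
      have hyi := hzu i τ hui
      cases τ with
      | const e =>
        exact (hy.fresh i hi (by rw [hyi]; exact hQ c hc _ ha i e hui)).elim
      | var v =>
        refine .inr ⟨v, rfl, fun k hk => ?_, ⟨⟨d.rhs, u⟩, i⟩, ⟨ha, hui⟩, ?_⟩
        · refine hy.fresh i hi ?_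
          have := hhead k
          rw [hk] at this
          rw [hyi, ← this]
          exact ht k
        · rintro ⟨b, i'⟩ ⟨hb, hbi⟩
          by_cases hne : b = ⟨d.rhs, u⟩
          · subst hne
            rw [hy.inj i hi i' ((hzu i' _ hbi).trans hyi.symm)]
          · obtain ⟨w, hw, hwb⟩ := hothers b hb hne
            refine (hy.fresh i hi ?_).elim
            rw [hyi, ← hwb i' _ hbi]
            exact hK _ hw i'
  refine ⟨⟨c.head, insert (d.rewriteAtom u) (c.body.erase ⟨d.rhs, u⟩)⟩,
    hrew c hc _ ⟨u, ha, happ, rfl, rfl⟩, ν, hhead, fun b hb => ?_⟩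
  rcases Finset.mem_insert.1 hb with rfl | hb
  · refine ⟨x, hx, fun i τ hτ => ?_⟩
    obtain ⟨j, rfl, hj⟩ := IND.exists_of_rewriteAtom_eq_some hτ
    rw [← hy.right, hzu _ _ hj]
  · exact hothers b (Finset.mem_of_mem_erase hb) (Finset.ne_of_mem_erase hb)

/-! ### The chase -/

theorem Schema.KeysHold.mono {S : Schema ar} {B B' : Set (DBFact ar Γ)} (h : B ⊆ B')
    (hB : S.KeysHold B') : S.KeysHold B :=
  fun r i hi x₁ x₂ hk hx => hB r i hi x₁ x₂ hk ⟨h hx.1, h hx.2.1, hx.2.2⟩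

/-- By NKC, either some key position is fresh, so no old fact shares the key, or the key equals the
propagated positions; then an old fact with the same key would already satisfy the IND for `x`. -/
theorem Schema.KeysHold.insert_freshImage {S : Schema ar} {d : IND ar} (hd : S.NKC d)
    {K : Set (DBFact ar Γ)} (hK : S.KeysHold K) {F : Set Γ} (hF : ValuesIn K F)
    {x : Fin (ar d.lhs) → Γ} {y : Fin (ar d.rhs) → Γ} (hy : d.FreshImage F x y)
    (hviol : ¬ ∃ z : Fin (ar d.rhs) → Γ, ⟨d.rhs, z⟩ ∈ K ∧ ∀ j, z (d.right j) = x (d.left j)) :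
    S.KeysHold (insert ⟨d.rhs, y⟩ K) := by
  have key : ∀ z : Fin (ar d.rhs) → Γ, ⟨d.rhs, z⟩ ∈ K → ¬ ∀ j ∈ S.key d.rhs, y j = z j := by
    intro z hz hyz
    by_cases hsub : S.key d.rhs ⊆ d.rightPos
    · have heq : d.rightPos ⊆ S.key d.rhs := by
        by_contra hne
        exact hd ⟨hsub, hne⟩
      exact hviol ⟨z, hz, fun j => by
        rw [← hyz _ (heq (IND.mem_rightPos.2 ⟨j, rfl⟩)), hy.right]⟩
    · obtain ⟨i, hi, hi'⟩ := Finset.not_subset.1 hsub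
      refine hy.fresh i hi' ?_
      rw [hyz i hi]
      exact hF _ hz i
  rintro r i hi x₁ x₂ hk ⟨h₁ | h₁, h₂ | h₂, hne⟩
  · cases h₁
    cases h₂
    exact hne rfl
  · cases h₁
    exact key x₂ h₂ hk
  · cases h₂
    exact key x₁ h₁ fun j hj => (hk j hj).symm
  · exact hK r i hi x₁ x₂ hk ⟨h₁, h₂, hne⟩

/-- `K'` is a finite database that satisfies the keys, extends `K`, and does not make `t` an
answer to `Q` unless it is one over `K`. -/
structure ConservativeExtension (S : Schema ar) (Q : Set (CQ ar Γ n)) (t : Fin n → Γ)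
    (K K' : Set (DBFact ar Γ)) : Prop where
  subset : K ⊆ K'
  finite : K'.Finite
  keysHold : S.KeysHold K'
  ans : (∃ c ∈ Q, t ∈ c.ans K') → ∃ c ∈ Q, t ∈ c.ans K

theorem ConservativeExtension.trans {S : Schema ar} {Q : Set (CQ ar Γ n)} {t : Fin n → Γ}
    {K₁ K₂ K₃ : Set (DBFact ar Γ)} (h₁ : ConservativeExtension S Q t K₁ K₂)
    (h₂ : ConservativeExtension S Q t K₂ K₃) : ConservativeExtension S Q t K₁ K₃ :=
  ⟨h₁.subset.trans h₂.subset, h₂.finite, h₂.keysHold, h₁.ans ∘ h₂.ans⟩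

theorem ConstantsIn.exists_finite {Q : Set (CQ ar Γ n)} (hQ : Q.Finite) :
    ∃ C : Set Γ, C.Finite ∧ ConstantsIn Q C := by
  refine ⟨⋃ c ∈ Q, ⋃ a ∈ c.body, (fun e => some (.const e)) ⁻¹' Set.range a.args, ?_, ?_⟩
  · refine hQ.biUnion fun c _ => c.body.finite_toSet.biUnion fun a _ =>
      (Set.finite_range a.args).preimage (Function.Injective.injOn fun e e' h => ?_)
    simpa using h
  · exact fun c hc a ha i e he => Set.mem_biUnion hc (Set.mem_biUnion ha ⟨i, he⟩)

theorem ValuesIn.exists_finite {K : Set (DBFact ar Γ)} (hK : K.Finite) :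
    ∃ C : Set Γ, C.Finite ∧ ValuesIn K C :=
  ⟨⋃ f ∈ K, Set.range f.args, hK.biUnion fun f _ => Set.finite_range f.args,
    fun _ hf i => Set.mem_biUnion hf ⟨i, rfl⟩⟩

variable [Infinite Γ] {S : Schema ar} {q : Finset (CQ ar Γ n)} {t : Fin n → Γ}

theorem exists_conservativeExtension_of_fact {d : IND ar} (hd : d ∈ S.inds) (hNKC : S.NKC d)
    {K : Set (DBFact ar Γ)} (hK : K.Finite) (hkey : S.KeysHold K) {x : Fin (ar d.lhs) → Γ}
    (hx : ⟨d.lhs, x⟩ ∈ K) :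
    ∃ K', ConservativeExtension S (perfectRewriting S q) t K K' ∧
      ∃ y : Fin (ar d.rhs) → Γ, ⟨d.rhs, y⟩ ∈ K' ∧ ∀ j, y (d.right j) = x (d.left j) := by
  by_cases hviol : ∃ z : Fin (ar d.rhs) → Γ, ⟨d.rhs, z⟩ ∈ K ∧ ∀ j, z (d.right j) = x (d.left j)
  · exact ⟨K, ⟨subset_rfl, hK, hkey, id⟩, hviol⟩
  obtain ⟨C, hC, hQC⟩ := ConstantsIn.exists_finite (perfectRewriting_finite S q)
  obtain ⟨V, hV, hKV⟩ := ValuesIn.exists_finite hK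
  -- Everything a fresh value must avoid; finiteness of the rewriting makes `C` finite.
  let F := C ∪ V ∪ Set.range t
  have hKF : ValuesIn K F := fun f hf i => .inl (.inr (hKV f hf i))
  obtain ⟨y, hy⟩ := d.exists_freshImage (F := F) ((hC.union hV).union (Set.finite_range t))
    fun i => hKF _ hx i
  refine ⟨insert ⟨d.rhs, y⟩ K, ⟨Set.subset_insert _ _, hK.insert _,
    hkey.insert_freshImage hNKC hKF hy hviol, ?_⟩, y, Set.mem_insert _ _, hy.right⟩
  exact ans_of_ans_insert_freshImage (fun c hc c' => perfectRewriting_reduces hc)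
    (fun c hc c' => perfectRewriting_rewritesBy hd hc) hKF
    (fun c hc a ha i e he => .inl (.inl (hQC c hc a ha i e he)))
    (fun k => .inr ⟨k, rfl⟩) hx hy

/-- One round of the chase: the finitely many pairs of an IND and a fact of `K` are served in turn.
Facts inserted meanwhile are left for the next round. -/
theorem exists_conservativeExtension (hNKC : ∀ d ∈ S.inds, S.NKC d)
    {K : Set (DBFact ar Γ)} (hK : K.Finite) (hkey : S.KeysHold K) :
    ∃ K', ConservativeExtension S (perfectRewriting S q) t K K' ∧
      ∀ d ∈ S.inds, ∀ x : Fin (ar d.lhs) → Γ, ⟨d.lhs, x⟩ ∈ K →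
        ∃ y : Fin (ar d.rhs) → Γ, ⟨d.rhs, y⟩ ∈ K' ∧ ∀ j, y (d.right j) = x (d.left j) := by
  classical
  have main : ∀ s : Finset (IND ar × DBFact ar Γ), (∀ p ∈ s, p.1 ∈ S.inds ∧ p.2 ∈ K) →
      ∃ K', ConservativeExtension S (perfectRewriting S q) t K K' ∧
        ∀ p ∈ s, ∀ x : Fin (ar p.1.lhs) → Γ, ⟨p.1.lhs, x⟩ = p.2 →
          ∃ y : Fin (ar p.1.rhs) → Γ, ⟨p.1.rhs, y⟩ ∈ K' ∧
            ∀ j, y (p.1.right j) = x (p.1.left j) := by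
    intro s
    induction s using Finset.induction_on with
    | empty => exact fun _ => ⟨K, ⟨subset_rfl, hK, hkey, id⟩, by simp⟩
    | insert p s _ ih =>
      intro hs
      obtain ⟨K₁, hK₁, h₁⟩ := ih fun p' hp' => hs p' (Finset.mem_insert_of_mem hp')
      obtain ⟨hd, hp⟩ := hs p (Finset.mem_insert_self _ _)
      by_cases hx : ∃ x : Fin (ar p.1.lhs) → Γ, ⟨p.1.lhs, x⟩ = p.2
      · obtain ⟨x, hx⟩ := hx
        obtain ⟨K₂, hK₂, h₂⟩ := exists_conservativeExtension_of_fact (q := q) (t := t) hd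
          (hNKC _ hd) hK₁.finite hK₁.keysHold (hK₁.subset (hx ▸ hp))
        refine ⟨K₂, hK₁.trans hK₂, fun p' hp' x' hx' => ?_⟩
        rcases Finset.mem_insert.1 hp' with rfl | hp'
        · have : x' = x := by simpa using hx'.trans hx.symm
          exact this ▸ h₂
        · obtain ⟨y, hy, hy'⟩ := h₁ p' hp' x' hx'
          exact ⟨y, hK₂.subset hy, hy'⟩
      · refine ⟨K₁, hK₁, fun p' hp' x' hx' => ?_⟩
        rcases Finset.mem_insert.1 hp' with rfl | hp'
        · exact (hx ⟨x', hx'⟩).elim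
        · exact h₁ p' hp' x' hx'
  obtain ⟨K', hK', h⟩ := main (S.inds ×ˢ hK.toFinset) (by simp)
  exact ⟨K', hK', fun d hd x hx => h (d, _) (by simpa using ⟨hd, hx⟩) x rfl⟩

/-- A finite database that satisfies the keys extends to a consistent one over which `t` is an
answer to the original query only if it is an answer to the perfect rewriting over the finite
database. -/
theorem exists_consistent_extension (hNKC : ∀ d ∈ S.inds, S.NKC d)
    {K : Set (DBFact ar Γ)} (hK : K.Finite) (hkey : S.KeysHold K) (q : Finset (CQ ar Γ n))
    (t : Fin n → Γ) :
    ∃ B, K ⊆ B ∧ S.Consistent B ∧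
      (t ∈ ucqAns q B → ∃ c ∈ perfectRewriting S q, t ∈ c.ans K) := by
  classical
  let E := {K' // ConservativeExtension S (perfectRewriting S q) t K K'}
  have hstep : ∀ K₁ : E, ∃ K₂ : E, K₁.1 ⊆ K₂.1 ∧
      ∀ d ∈ S.inds, ∀ x : Fin (ar d.lhs) → Γ, ⟨d.lhs, x⟩ ∈ K₁.1 →
        ∃ y : Fin (ar d.rhs) → Γ, ⟨d.rhs, y⟩ ∈ K₂.1 ∧ ∀ j, y (d.right j) = x (d.left j) := by
    rintro ⟨K₁, h₁⟩
    obtain ⟨K₂, h₂, h⟩ :=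
      exists_conservativeExtension (q := q) (t := t) hNKC h₁.finite h₁.keysHold
    exact ⟨⟨K₂, h₁.trans h₂⟩, h₂.subset, h⟩
  choose next hnext hind using hstep
  let C : ℕ → E := fun m => next^[m] ⟨K, subset_rfl, hK, hkey, id⟩
  have hC : ∀ m, C (m + 1) = next (C m) := fun m => Function.iterate_succ_apply' _ _ _
  have hmono : Monotone fun m => (C m).1 := monotone_nat_of_le_succ fun m => by
    rw [hC]
    exact hnext _
  refine ⟨⋃ m, (C m).1, (Set.subset_iUnion (fun m => (C m).1) 0), ⟨?_, ?_⟩, ?_⟩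
  · rintro r i hi x₁ x₂ hk ⟨h₁, h₂, hne⟩
    obtain ⟨m₁, h₁⟩ := Set.mem_iUnion.1 h₁
    obtain ⟨m₂, h₂⟩ := Set.mem_iUnion.1 h₂
    exact (C (max m₁ m₂)).2.keysHold r i hi x₁ x₂ hk
      ⟨hmono (le_max_left m₁ m₂) h₁, hmono (le_max_right m₁ m₂) h₂, hne⟩
  · intro d hd x hx
    obtain ⟨m, hx⟩ := Set.mem_iUnion.1 hx
    obtain ⟨y, hy, hyx⟩ := hind (C m) d hd x hx
    exact ⟨y, Set.mem_iUnion.2 ⟨m + 1, by rw [hC]; exact hy⟩, hyx⟩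
  · rintro ⟨c, hc, ν, hhead, hν⟩
    -- The finitely many facts used by a match already lie in one stage, where conservativity
    -- applies.
    have hstage : ∀ a ∈ c.body, ∃ m, a.Sat ν (C m).1 := fun a ha => by
      obtain ⟨x, hx, hxa⟩ := hν a ha
      obtain ⟨m, hm⟩ := Set.mem_iUnion.1 hx
      exact ⟨m, x, hm, hxa⟩
    choose! stage hstage using hstage
    refine (C (c.body.sup stage)).2.ans ⟨c, subset_perfectRewriting S q hc, ν, hhead, ?_⟩
    exact fun a ha => (hstage a ha).mono (hmono (Finset.le_sup ha))

end Chase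

section AnswerSets

variable {R : Type*} {ar : R → ℕ} {Γ : Type*} {n : ℕ}

/-! ### The reduct of the program -/

theorem isModel_reduct_grounding_iff {P : Set (AspRule ar Γ n)} {M N : Set (AspAtom ar n Γ)} :
    IsModel (reduct (grounding P) M) N ↔ ∀ ρ ∈ P, ∀ ν : PVar ar Γ → Γ,
      (∀ e ∈ ρ.neq, e.1.eval ν ≠ e.2.eval ν) → (∀ a ∈ ρ.neg, a.map (Term.eval ν) ∉ M) →
      (∀ a ∈ ρ.pos, a.map (Term.eval ν) ∈ N) → ∃ a ∈ ρ.head, a.map (Term.eval ν) ∈ N := by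
  constructor
  · intro h ρ hρ ν hneq hneg hpos
    have := h _ ⟨ρ.ground ν, ⟨ρ, hρ, ν, hneq, rfl⟩, by simpa [AspRule.ground] using hneg, rfl⟩
    simp only [GroundRule.Sat, AspRule.ground, List.mem_map, forall_exists_index, and_imp,
      forall_apply_eq_imp_iff₂, exists_exists_and_eq_and] at this
    exact this hpos (by simp)
  · rintro h _ ⟨_, ⟨ρ, hρ, ν, hneq, rfl⟩, hneg, rfl⟩
    simp only [AspRule.ground, List.mem_map, forall_exists_index, and_imp,
      forall_apply_eq_imp_iff₂] at hneg
    simp only [GroundRule.Sat, AspRule.ground, List.mem_map, forall_exists_index, and_imp,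
      forall_apply_eq_imp_iff₂, exists_exists_and_eq_and]
    exact fun hpos _ => h ρ hρ ν hneq hneg hpos

/-- Two facts `r(x₁)` and `r(x₂)` agree on the key and differ at a non-key position. -/
def Schema.Conflict (S : Schema ar) (r : R) (x₁ x₂ : Fin (ar r) → Γ) : Prop :=
  (∀ j ∈ S.key r, x₁ j = x₂ j) ∧ ∃ i, i ∉ S.key r ∧ x₁ i ≠ x₂ i

theorem Schema.Conflict.symm {S : Schema ar} {r : R} {x₁ x₂ : Fin (ar r) → Γ}
    (h : S.Conflict r x₁ x₂) : S.Conflict r x₂ x₁ :=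
  ⟨fun j hj => (h.1 j hj).symm, h.2.imp fun _ hi => ⟨hi.1, hi.2.symm⟩⟩

theorem Schema.Conflict.ne {S : Schema ar} {r : R} {x₁ x₂ : Fin (ar r) → Γ}
    (h : S.Conflict r x₁ x₂) : x₁ ≠ x₂ := by
  rintro rfl
  obtain ⟨i, -, hi⟩ := h.2
  exact hi rfl

theorem Schema.keysHold_iff {S : Schema ar} {B : Set (DBFact ar Γ)} :
    S.KeysHold B ↔ ∀ (r : R) (x₁ x₂ : Fin (ar r) → Γ), S.Conflict r x₁ x₂ → ⟨r, x₁⟩ ∈ B →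
      ⟨r, x₂⟩ ∉ B :=
  ⟨fun h r x₁ x₂ ⟨hk, i, hi, hne⟩ h₁ h₂ => h r i hi x₁ x₂ hk ⟨h₁, h₂, hne⟩,
    fun h r i hi x₁ x₂ hk hx => h r x₁ x₂ ⟨hk, i, hi, hx.2.2⟩ hx.1 hx.2.1⟩

theorem exists_valuation_keyVars [Nonempty Γ] (S : Schema ar) {r : R} {x₁ x₂ : Fin (ar r) → Γ}
    (h : ∀ j ∈ S.key r, x₁ j = x₂ j) : ∃ ν : PVar ar Γ → Γ,
      (∀ i, (keyVars₁ r i : Term (PVar ar Γ) Γ).eval ν = x₁ i) ∧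
      ∀ i, (keyVars₂ S r i : Term (PVar ar Γ) Γ).eval ν = x₂ i := by
  obtain ⟨c⟩ := ‹Nonempty Γ›
  -- Variables below `ar r` carry `x₁`, those shifted by `ar r` carry `x₂`; all others get the
  -- irrelevant default `c`.
  refine ⟨Sum.elim (fun k => if hk : k < ar r then x₁ ⟨k, hk⟩ else
    if hk : k - ar r < ar r then x₂ ⟨k - ar r, hk⟩ else c) fun _ => c, fun i => ?_, fun i => ?_⟩
  · simp [keyVars₁, Term.eval]
  · by_cases hi : i ∈ S.key r
    · simp [keyVars₂, Term.eval, hi, h i hi]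
    · simp [keyVars₂, Term.eval, hi]

theorem eval_keyVars_eq (S : Schema ar) {r : R} (ν : PVar ar Γ → Γ) :
    ∀ j ∈ S.key r, (keyVars₁ r j : Term (PVar ar Γ) Γ).eval ν = (keyVars₂ S r j).eval ν := by
  intro j hj
  simp [keyVars₁, keyVars₂, hj]

/-- The database of the repaired facts in `N`. -/
def repairedFacts (N : Set (AspAtom ar n Γ)) : Set (DBFact ar Γ) :=
  {f | .rep f.rel f.args ∈ N}

theorem models_factRules_iff {D : Set (DBFact ar Γ)} {M N : Set (AspAtom ar n Γ)} [Nonempty Γ] :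
    IsModel (reduct (grounding (factRules n D)) M) N ↔ ∀ f ∈ D, .base f.rel f.args ∈ N := by
  rw [isModel_reduct_grounding_iff]
  constructor
  · intro h f hf
    obtain ⟨a, ha, h⟩ := h _ ⟨f, hf, rfl⟩ (fun _ => Classical.arbitrary Γ) (by simp) (by simp)
      (by simp)
    rw [List.mem_singleton.1 ha] at h
    exact h
  · rintro h _ ⟨f, hf, rfl⟩ ν - - -
    exact ⟨_, List.mem_singleton_self _, h f hf⟩

theorem models_keyRules_iff [Nonempty Γ] {S : Schema ar} {M N : Set (AspAtom ar n Γ)} :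
    IsModel (reduct (grounding (keyRules S)) M) N ↔ ∀ (r : R) (x₁ x₂ : Fin (ar r) → Γ),
      S.Conflict r x₁ x₂ → .base r x₁ ∈ N → .base r x₂ ∈ N → .del r x₁ ∈ N ∨ .del r x₂ ∈ N := by
  rw [isModel_reduct_grounding_iff]
  constructor
  · rintro h r x₁ x₂ ⟨hk, i, hi, hne⟩ h₁ h₂
    obtain ⟨ν, hν₁, hν₂⟩ := exists_valuation_keyVars S hk
    have e₁ : Term.eval ν ∘ keyVars₁ r = x₁ := funext hν₁
    have e₂ : Term.eval ν ∘ keyVars₂ S r = x₂ := funext hν₂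
    have := h _ ⟨r, i, hi, rfl⟩ ν
    simp only [List.mem_cons, List.not_mem_nil, or_false, forall_eq_or_imp, forall_eq,
      exists_eq_or_imp, exists_eq_left, AspAtom.map, e₁, e₂, hν₁, hν₂] at this
    exact this hne (by simp) ⟨h₁, h₂⟩
  · rintro h _ ⟨r, i, hi, rfl⟩ ν
    simp only [List.mem_cons, List.not_mem_nil, or_false, forall_eq_or_imp, forall_eq,
      exists_eq_or_imp, exists_eq_left, AspAtom.map]
    exact fun hne _ hpos => h r _ _ ⟨eval_keyVars_eq S ν, i, hi, hne⟩ hpos.1 hpos.2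

theorem models_repairRules_iff [Nonempty Γ] {M N : Set (AspAtom ar n Γ)} :
    IsModel (reduct (grounding repairRules) M) N ↔ ∀ (r : R) (x : Fin (ar r) → Γ),
      .del r x ∉ M → .base r x ∈ N → .rep r x ∈ N := by
  rw [isModel_reduct_grounding_iff]
  constructor
  · intro h r x hx hx'
    -- Any schema serves here, since only the first variable sequence is used.
    obtain ⟨ν, hν, -⟩ := exists_valuation_keyVars (⟨fun _ => ∅, ∅⟩ : Schema ar) (r := r)
      (x₁ := x) (x₂ := x) fun _ _ => rfl
    have e : Term.eval ν ∘ keyVars₁ r = x := funext hν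
    have := h _ ⟨r, rfl⟩ ν
    simp only [List.mem_cons, List.not_mem_nil, or_false, forall_eq, exists_eq_left,
      AspAtom.map, e] at this
    exact this (by simp) hx hx'
  · rintro h _ ⟨r, rfl⟩ ν
    simp only [List.mem_cons, List.not_mem_nil, or_false, forall_eq, exists_eq_left,
      AspAtom.map]
    exact fun _ => h r _

theorem QAtom.map_repaired (μ : PVar ar Γ → Γ) (a : QAtom ar Γ) :
    (QAtom.repaired n a).map (Term.eval μ) = .rep a.rel fun i =>
      (a.args i).elim (μ (.inr (a, i))) (Term.eval fun v => μ (.inl v)) := by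
  refine congrArg (AspAtom.rep a.rel) (funext fun i => ?_)
  simp only [Function.comp_apply]
  cases a.args i with
  | none => rfl
  | some τ => exact Term.eval_subst _ _ _

theorem CQ.mem_ans_iff_exists_pvar [Nonempty Γ] {c : CQ ar Γ n} {N : Set (AspAtom ar n Γ)}
    {t : Fin n → Γ} : t ∈ c.ans (repairedFacts N) ↔ ∃ ν : PVar ar Γ → Γ,
      (∀ a ∈ c.body, (QAtom.repaired n a).map (Term.eval ν) ∈ N) ∧
      ∀ k, t k = ((c.head k).subst fun v => .var (.inl v)).eval ν := by
  classical
  constructor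
  · rintro ⟨ν, hhead, hν⟩
    have hν' : ∀ a : QAtom ar Γ, ∃ x : Fin (ar a.rel) → Γ, a ∈ c.body →
        (⟨a.rel, x⟩ : DBFact ar Γ) ∈ repairedFacts N ∧
          ∀ i, ∀ τ ∈ a.args i, x i = τ.eval ν := fun a => by
      by_cases ha : a ∈ c.body
      · exact (hν a ha).imp fun x hx _ => hx
      · exact ⟨fun _ => Classical.arbitrary Γ, fun h => (ha h).elim⟩
    choose x hx using hν'
    -- Each anonymous position owns its variable, so it can take the value in the fact chosen for
    -- its atom.
    let μ : PVar ar Γ → Γ := Sum.elim ν fun p =>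
      if h : p.2 < ar p.1.rel then x p.1 ⟨p.2, h⟩ else Classical.arbitrary Γ
    refine ⟨μ, fun a ha => ?_, fun k => ?_⟩
    · rw [QAtom.map_repaired]
      convert (hx a ha).1 using 1
      simp only [repairedFacts, Set.mem_ofPred_eq]
      congr! with i
      cases hi : a.args i with
      | none => simp [μ]
      | some τ => exact ((hx a ha).2 i τ hi).symm
    · rw [hhead, Term.eval_subst]
      rfl
  · rintro ⟨μ, hbody, hhead⟩
    refine ⟨fun v => μ (.inl v), fun k => ?_, fun a ha => ?_⟩
    · rw [hhead, Term.eval_subst]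
      rfl
    · have := hbody a ha
      rw [QAtom.map_repaired] at this
      exact ⟨_, this, fun i τ hτ => by simp [Option.mem_def.1 hτ]⟩

theorem models_queryRules_iff [Nonempty Γ] {S : Schema ar} {q : Finset (CQ ar Γ n)}
    {M N : Set (AspAtom ar n Γ)} :
    IsModel (reduct (grounding (queryRules S q)) M) N ↔
      ∀ c ∈ perfectRewriting S q, ∀ t ∈ c.ans (repairedFacts N), .query t ∈ N := by
  rw [isModel_reduct_grounding_iff]
  simp only [queryRules, Set.forall_mem_image, CQ.toRule, List.mem_map, Finset.mem_toList,
    forall_exists_index, and_imp, forall_apply_eq_imp_iff₂, List.mem_singleton, exists_eq_left,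
    List.not_mem_nil, false_imp_iff, implies_true, true_imp_iff, AspAtom.map,
    CQ.mem_ans_iff_exists_pvar]
  refine forall₂_congr fun c _ => ⟨fun h t ν hν ht => ?_, fun h ν hν => ?_⟩
  · rw [show t = _ from funext ht]
    exact h ν hν
  · exact h _ ν hν fun _ => rfl

theorem isModel_reduct_grounding_union {P P' : Set (AspRule ar Γ n)}
    {M N : Set (AspAtom ar n Γ)} : IsModel (reduct (grounding (P ∪ P')) M) N ↔
      IsModel (reduct (grounding P) M) N ∧ IsModel (reduct (grounding P') M) N := by
  simp only [isModel_reduct_grounding_iff, Set.mem_union, or_imp, forall_and]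

/-- The ground program: the facts of `D` and the rules for the repairs and the query. -/
abbrev fullProgram (S : Schema ar) (D : Set (DBFact ar Γ)) (q : Finset (CQ ar Γ n)) :
    Set (GroundRule (AspAtom ar n Γ)) :=
  grounding (factRules n D ∪ cqaProgram S q)

/-- Default negation occurs only in the repair rules, so `M` enters only their clause. -/
theorem isModel_reduct_fullProgram_iff [Nonempty Γ] {S : Schema ar} {D : Set (DBFact ar Γ)}
    {q : Finset (CQ ar Γ n)} {M N : Set (AspAtom ar n Γ)} :
    IsModel (reduct (fullProgram S D q) M) N ↔
      (∀ f ∈ D, .base f.rel f.args ∈ N) ∧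
      (∀ (r : R) (x₁ x₂ : Fin (ar r) → Γ), S.Conflict r x₁ x₂ → .base r x₁ ∈ N →
        .base r x₂ ∈ N → .del r x₁ ∈ N ∨ .del r x₂ ∈ N) ∧
      (∀ (r : R) (x : Fin (ar r) → Γ), .del r x ∉ M → .base r x ∈ N → .rep r x ∈ N) ∧
      ∀ c ∈ perfectRewriting S q, ∀ t ∈ c.ans (repairedFacts N), .query t ∈ N := by
  rw [fullProgram, cqaProgram, isModel_reduct_grounding_union, isModel_reduct_grounding_union,
    isModel_reduct_grounding_union, models_factRules_iff, models_keyRules_iff,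
    models_repairRules_iff, models_queryRules_iff, and_assoc]

/-! ### Answer sets and maximal key-consistent subsets -/

/-- `K` is a maximal subset of `D` that satisfies the keys. -/
def IsKeyRepair (S : Schema ar) (D K : Set (DBFact ar Γ)) : Prop :=
  Maximal (fun K => K ⊆ D ∧ S.KeysHold K) K

/-- The interpretation with base facts `D`, deleted facts `X`, repaired facts `K`, and the answers
to the perfect rewriting of `q` over `K`. -/
def interpretation (S : Schema ar) (q : Finset (CQ ar Γ n)) (D X K : Set (DBFact ar Γ)) :
    Set (AspAtom ar n Γ)
  | .base r x => ⟨r, x⟩ ∈ D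
  | .del r x => ⟨r, x⟩ ∈ X
  | .rep r x => ⟨r, x⟩ ∈ K
  | .query t => ∃ c ∈ perfectRewriting S q, t ∈ c.ans K

theorem interpretation_subset_iff {S : Schema ar} {q : Finset (CQ ar Γ n)}
    {D X K : Set (DBFact ar Γ)} {M : Set (AspAtom ar n Γ)} :
    interpretation S q D X K ⊆ M ↔
      (∀ f ∈ D, .base f.rel f.args ∈ M) ∧ (∀ f ∈ X, .del f.rel f.args ∈ M) ∧
      K ⊆ repairedFacts M ∧ ∀ c ∈ perfectRewriting S q, ∀ t ∈ c.ans K, .query t ∈ M := by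
  constructor
  · exact fun h => ⟨fun f hf => h (a := .base f.rel f.args) hf,
      fun f hf => h (a := .del f.rel f.args) hf, fun f hf => h (a := .rep f.rel f.args) hf,
      fun c hc t ht => h (a := .query t) ⟨c, hc, ht⟩⟩
  · rintro ⟨h₁, h₂, h₃, h₄⟩ (⟨r, x⟩ | ⟨r, x⟩ | ⟨r, x⟩ | t) h
    · exact h₁ ⟨r, x⟩ h
    · exact h₂ ⟨r, x⟩ h
    · exact h₃ h
    · obtain ⟨c, hc, ht⟩ := h
      exact h₄ c hc t ht

/-- A key repair determines an answer set. -/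
theorem IsKeyRepair.isAnswerSet [Nonempty Γ] {S : Schema ar} {q : Finset (CQ ar Γ n)}
    {D K : Set (DBFact ar Γ)} (h : IsKeyRepair S D K) :
    IsAnswerSet (fullProgram S D q) (interpretation S q D (D \ K) K) := by
  have hkey := Schema.keysHold_iff.1 h.prop.2
  -- By maximality of `K`, every deleted fact conflicts with a kept one. Since the kept one cannot
  -- be deleted in `N`, this later forces the deletion of `f` there.
  have hdel : ∀ f ∈ D \ K, ∃ x, (⟨f.rel, x⟩ : DBFact ar Γ) ∈ K ∧ S.Conflict f.rel f.args x := by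
    rintro f ⟨hf, hfK⟩
    by_contra! hcon
    refine hfK (h.le_of_ge ⟨Set.insert_subset hf h.prop.1, Schema.keysHold_iff.2 ?_⟩
      (Set.subset_insert f K) (Set.mem_insert f K))
    rintro r x₁ x₂ hc (rfl | h₁) (h₂ | h₂)
    · exact hc.ne (by simpa using h₂.symm)
    · exact hcon x₂ h₂ hc
    · subst h₂
      exact hcon x₁ h₁ hc.symm
    · exact hkey r x₁ x₂ hc h₁ h₂
  refine ⟨isModel_reduct_fullProgram_iff.2 ⟨fun f hf => hf, fun r x₁ x₂ hc h₁ h₂ => ?_,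
    fun r x hx hx' => ?_, fun c hc t ht => ⟨c, hc, ht⟩⟩, fun N hN hmod => ?_⟩
  · by_cases hx : (⟨r, x₁⟩ : DBFact ar Γ) ∈ K
    · exact .inr ⟨h₂, hkey r x₁ x₂ hc hx⟩
    · exact .inl ⟨h₁, hx⟩
  · by_contra hK
    exact hx ⟨hx', hK⟩
  · obtain ⟨h₁, h₂, h₃, h₄⟩ := isModel_reduct_fullProgram_iff.1 hmod
    have hK : K ⊆ repairedFacts N := fun f hf =>
      h₃ f.rel f.args (fun hf' => hf'.2 hf) (h₁ f (h.prop.1 hf))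
    refine hN.antisymm (interpretation_subset_iff.2 ⟨h₁, fun f hf => ?_, hK,
      fun c hc t ht => h₄ c hc t (c.ans_mono hK ht)⟩)
    obtain ⟨x, hx, hc⟩ := hdel f hf
    refine (h₂ f.rel f.args x hc (h₁ f hf.1) (h₁ ⟨f.rel, x⟩ (h.prop.1 hx))).resolve_right ?_
    exact fun hx' => (hN hx').2 hx

/-- An answer set determines a key repair, whose answers to the perfect rewriting it contains. -/
theorem IsAnswerSet.exists_isKeyRepair [Nonempty Γ] {S : Schema ar} {q : Finset (CQ ar Γ n)}
    {D : Set (DBFact ar Γ)} {M : Set (AspAtom ar n Γ)} (h : IsAnswerSet (fullProgram S D q) M) :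
    ∃ K, IsKeyRepair S D K ∧ ∀ c ∈ perfectRewriting S q, ∀ t ∈ c.ans K, .query t ∈ M := by
  obtain ⟨h₁, h₂, h₃, h₄⟩ := isModel_reduct_fullProgram_iff.1 h.1
  let K : Set (DBFact ar Γ) := {f | f ∈ D ∧ .del f.rel f.args ∉ M}
  have hKM : K ⊆ repairedFacts M := fun f hf => h₃ f.rel f.args hf.2 (h₁ f hf.1)
  have hans : ∀ c ∈ perfectRewriting S q, ∀ t ∈ c.ans K, .query t ∈ M :=
    fun c hc t ht => h₄ c hc t (c.ans_mono hKM ht)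
  -- The deletions in `M` form a minimal hitting set: the reduct is fixed by `M`, so shrinking `X`
  -- creates no new repaired facts and `K` can stay the same.
  have hmin : ∀ X ⊆ {f : DBFact ar Γ | .del f.rel f.args ∈ M},
      (∀ (r : R) (x₁ x₂ : Fin (ar r) → Γ), S.Conflict r x₁ x₂ → ⟨r, x₁⟩ ∈ D → ⟨r, x₂⟩ ∈ D →
        ⟨r, x₁⟩ ∈ X ∨ ⟨r, x₂⟩ ∈ X) → ∀ f : DBFact ar Γ, .del f.rel f.args ∈ M → f ∈ X := by
    intro X hX hhit f hf
    have := h.2 (interpretation S q D X K)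
      (interpretation_subset_iff.2 ⟨h₁, hX, hKM, hans⟩)
      (isModel_reduct_fullProgram_iff.2 ⟨fun f hf => hf, hhit, fun r x hx hx' => ⟨hx', hx⟩,
        fun c hc t ht => ⟨c, hc, ht⟩⟩)
    rw [← this] at hf
    exact hf
  refine ⟨K, ⟨⟨fun f hf => hf.1, Schema.keysHold_iff.2 fun r x₁ x₂ hc hx₁ hx₂ => ?_⟩, ?_⟩, hans⟩
  · exact (h₂ r x₁ x₂ hc (h₁ _ hx₁.1) (h₁ _ hx₂.1)).elim hx₁.2 hx₂.2
  · rintro K' ⟨hK'D, hK'⟩ hKK' f hf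
    refine ⟨hK'D hf, fun hfM => ?_⟩
    -- Undeleting `f` still leaves every conflict hit: a fact of `D` conflicting with `f` cannot be
    -- in `K ⊆ K'`, so it is itself deleted.
    refine (hmin ({f' | .del f'.rel f'.args ∈ M} \ {f}) Set.sdiff_subset ?_ f hfM).2 rfl
    have hf' : ∀ (r : R) (x₁ x₂ : Fin (ar r) → Γ), S.Conflict r x₁ x₂ → ⟨r, x₂⟩ ∈ D →
        (⟨r, x₁⟩ : DBFact ar Γ) = f → .del r x₂ ∈ M ∧ (⟨r, x₂⟩ : DBFact ar Γ) ≠ f := by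
      rintro r x₁ x₂ hc hx₂ rfl
      refine ⟨?_, fun e => hc.ne (by simpa using e.symm)⟩
      by_contra hM
      exact Schema.keysHold_iff.1 hK' r x₁ x₂ hc hf (hKK' ⟨hx₂, hM⟩)
    intro r x₁ x₂ hc hx₁ hx₂
    by_cases e₁ : (⟨r, x₁⟩ : DBFact ar Γ) = f
    · exact .inr (hf' r x₁ x₂ hc hx₂ e₁)
    by_cases e₂ : (⟨r, x₂⟩ : DBFact ar Γ) = f
    · exact .inl (hf' r x₂ x₁ hc.symm hx₁ e₂)
    exact (h₂ r x₁ x₂ hc (h₁ _ hx₁) (h₁ _ hx₂)).imp (fun h => ⟨h, e₁⟩) fun h => ⟨h, e₂⟩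

/-! ### Loosely-sound repairs and maximal key-consistent subsets -/

variable [Infinite Γ] {S : Schema ar} {D : Set (DBFact ar Γ)}

theorem IsLooselySoundRepair.isKeyRepair (hNKC : ∀ d ∈ S.inds, S.NKC d) (hD : D.Finite)
    {B : Set (DBFact ar Γ)} (h : IsLooselySoundRepair S D B) : IsKeyRepair S D (B ∩ D) := by
  refine ⟨⟨Set.inter_subset_right, h.1.1.mono Set.inter_subset_left⟩, ?_⟩
  rintro K ⟨hKD, hK⟩ hBK
  by_contra hne
  -- Only the consistent extension matters, so the empty query is supplied.
  obtain ⟨B', hKB', hB', -⟩ := exists_consistent_extension hNKC (hD.subset hKD) hK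
    (∅ : Finset (CQ ar Γ 0)) Fin.elim0
  have hKB : K ⊆ B' ∩ D := Set.subset_inter hKB' hKD
  exact h.2 ⟨B', hB', Set.Subset.trans hBK hKB, fun hsub => hne (hKB.trans hsub)⟩

/-- The chase of `K` is a repair: a consistent `B'` retaining more of `D` would give a
key-consistent `B' ∩ D` beyond the maximal `K`. -/
theorem IsKeyRepair.exists_isLooselySoundRepair (hNKC : ∀ d ∈ S.inds, S.NKC d) (hD : D.Finite)
    {K : Set (DBFact ar Γ)} (h : IsKeyRepair S D K) (q : Finset (CQ ar Γ n)) (t : Fin n → Γ) :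
    ∃ B, IsLooselySoundRepair S D B ∧
      (t ∈ ucqAns q B → ∃ c ∈ perfectRewriting S q, t ∈ c.ans K) := by
  obtain ⟨B, hKB, hB, hans⟩ :=
    exists_consistent_extension hNKC (hD.subset h.prop.1) h.prop.2 q t
  refine ⟨B, ⟨hB, ?_⟩, hans⟩
  rintro ⟨B', hB', hsub, hne⟩
  have hKB' : K ⊆ B ∩ D := Set.subset_inter hKB h.prop.1
  exact hne ((h.le_of_ge ⟨Set.inter_subset_right, hB'.1.mono Set.inter_subset_left⟩
    (hKB'.trans hsub)).trans hKB')

end AnswerSets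

end CQA

theorem mainTheorem6 {R Γ : Type*} [Infinite Γ] {ar : R → ℕ}
    (S : CQA.Schema ar) (hNKC : ∀ d ∈ S.inds, S.NKC d)
    (D : Set (CQA.DBFact ar Γ)) (hD : D.Finite)
    {n : ℕ} (q : Finset (CQA.CQ ar Γ n)) (hq : ∀ c ∈ q, c.Safe) :
    (CQA.perfectRewriting S q).Finite ∧
      ∀ t : Fin n → Γ,
        t ∈ CQA.consistentAnswers S D q ↔
          CQA.IsCautiousConsequence (CQA.factRules n D ∪ CQA.cqaProgram S q)
            (CQA.AspAtom.query t) := by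
  refine ⟨CQA.perfectRewriting_finite S q, fun t => ⟨fun ht M hM => ?_, fun ht B hB => ?_⟩⟩
  · obtain ⟨K, hK, hans⟩ := CQA.IsAnswerSet.exists_isKeyRepair hM
    obtain ⟨B, hB, hBK⟩ := hK.exists_isLooselySoundRepair hNKC hD q t
    obtain ⟨c, hc, hct⟩ := hBK (ht B hB)
    exact hans c hc t hct
  -- Membership of the query atom in the interpretation built from `B ∩ D` unfolds to an answer of
  -- the rewriting over `B ∩ D`.
  · obtain ⟨c, hc, hct⟩ := ht _ (hB.isKeyRepair hNKC hD).isAnswerSet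
    exact CQA.mem_ucqAns_of_mem_perfectRewriting hB.1.2 hc
      (c.ans_mono Set.inter_subset_left hct)
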